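/- Let $k\ge 2$ be an integer. A positive integer $N$ is called $k$-full if $p^k\mid N$ for every prime $p\mid N$; let $\mathcal S_k$ be the set of all $k$-full integers that are not perfect $k$th powers. For integers $\ell,m\ge 0$ put $$\mathcal A_{\ell}^{(k)}:=\bigl\{n\in\mathbb Z_{\ge1} : \#\bigl((n^k,(n+1)^k)\cap\mathcal S_k\bigr)=\ell\bigr\},$$ $$\mathcal A_{\ell,m}^{(k)}:=\bigl\{n\in\mathbb Z_{\ge1} : \#\bigl((n^k,(n+1)^k)\cap\mathcal S_k\bigr)=\ell,\ \#\bigl(((n+1)^k,(n+2)^k)\cap\mathcal S_k\bigr)=m\bigr\}.$$ For a set $\mathcal A$ of positive integers let $d(\mathcal A):=\lim_{x\to\infty}\#\{n\in\mathcal A: n\le x\}/x$ be its asymptotic density, provided this limit exists. Then for all integers $\ell,m\ge 0$ the densities $d(\mathcal A_{\ell,m}^{(k)})$ and $d(\mathcal A_{j}^{(k)})$ $(j\ge0)$ exist, and $$d(\mathcal A_{\ell,m}^{(k)})=\sum_{n\ge0}(-1)^n\binom{\ell+m+n}{\ell,m,n}\,d(\mathcal A_{\ell+m+n}^{(k)}),$$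 where the series converges absolutely and $\binom{\ell+m+n}{\ell,m,n}=\frac{(\ell+m+n)!}{\ell!\,m!\,n!}$ is the trinomial coefficient. -/

import Mathlib

open Filter Topology

/-- `n` is a `k`-full integer: a positive integer such that `p ^ k` divides `n` for every
prime factor `p` of `n`. -/
def IsKFull (k n : ℕ) : Prop :=
  0 < n ∧ ∀ p : ℕ, p.Prime → p ∣ n → p ^ k ∣ n

/-- The set `𝒮_k` of all `k`-full integers that are not perfect `k`-th powers. -/
def nonPowerKFull (k : ℕ) : Set ℕ :=
  {n | IsKFull k n ∧ ¬ ∃ a : ℕ, n = a ^ k}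

/-- The set `𝒜_ℓ^{(k)}` of all positive integers `n` such that the open interval
`(n ^ k, (n + 1) ^ k)` contains exactly `ℓ` elements of `𝒮_k`. -/
def oneIntervalSet (k l : ℕ) : Set ℕ :=
  {n | 0 < n ∧ (Set.Ioo (n ^ k) ((n + 1) ^ k) ∩ nonPowerKFull k).ncard = l}

/-- The set `𝒜_{ℓ,m}^{(k)}` of all positive integers `n` such that the open intervals
`(n ^ k, (n + 1) ^ k)` and `((n + 1) ^ k, (n + 2) ^ k)` contain exactly `ℓ` and `m` elements
of `𝒮_k`, respectively. -/
def twoIntervalSet (k l m : ℕ) : Set ℕ :=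
  {n | 0 < n ∧ (Set.Ioo (n ^ k) ((n + 1) ^ k) ∩ nonPowerKFull k).ncard = l ∧
    (Set.Ioo ((n + 1) ^ k) ((n + 2) ^ k) ∩ nonPowerKFull k).ncard = m}

/-- `𝒜(x)`: the number of elements of `𝒜` not exceeding the real number `x`. -/
noncomputable def countUpTo (A : Set ℕ) (x : ℝ) : ℕ :=
  {n : ℕ | n ∈ A ∧ (n : ℝ) ≤ x}.ncard

/-- `𝒜` has asymptotic density `d`: the limit of `𝒜(x) / x` as `x → ∞` exists and equals `d`. -/
def HasAsymptoticDensity (A : Set ℕ) (d : ℝ) : Prop :=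
  Tendsto (fun x : ℝ => (countUpTo A x : ℝ) / x) atTop (𝓝 d)

/-- The asymptotic density `d(𝒜) = lim 𝒜(x) / x` (meaningful when the limit exists). -/
noncomputable def asymptoticDensity (A : Set ℕ) : ℝ :=
  limUnder atTop (fun x : ℝ => (countUpTo A x : ℝ) / x)

/-! Every `k`-full integer is `a ^ k * B` for a unique `B` whose nonzero prime exponents lie
strictly between `k` and `2 * k`, and it is a `k`-th power exactly when `B = 1`. With `α = B ^ (-1 /
k)`, such a number lies in `(n ^ k, (n + 1) ^ k)` iff `n α < a < (n + 1) α`. Since `B ≠ 1` forces `α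
< 1 / 2`, each `B` contributes at most one element to the two consecutive intervals together.
Whether it hits the first, the second or neither depends only on the fractional part of `n α`; the
corresponding arcs have lengths `α`, `α`, `1 - 2 α`.

Together with `1`, these `α` are linearly independent over the rationals
(`linearIndependent_radicals`, by a trace argument), so Weyl equidistribution
(`tendsto_orbitAverage`, `hasNatDensity_box`) makes the states of finitely many `B` independent. For
a finite set `S` of `B` the single count thus has generating function `F(X) = ∏ (1 - α + α X)` and
the joint count has `∏ (1 - 2 α + α X + α Y) = F(X + Y - 1)`. Comparing coefficients of `X ^ l Y ^
m` gives the trinomial identity for `S`.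

An Euler product shows that `∑ α` converges. Hence the `n` affected by some `B` outside `S` have
small upper density, the densities exist, and they are limits of those for `S`
(`exists_tendsto_of_approximation`). The bound `(∑ α) ^ j / j!` on the coefficients of `F`, uniform
in `S`, lets dominated convergence carry the identity to the limit. -/

/-! ### Weyl equidistribution on the torus -/

open MeasureTheory in
theorem integral_fourier_of_ne_zero {n : ℤ} (hn : n ≠ 0) :
    ∫ x : UnitAddCircle, fourier n x ∂AddCircle.haarAddCircle = 0 := by
  have h := (orthonormal_iff_ite.mp (orthonormal_fourier (T := 1))) 0 n
  rw [if_neg (Ne.symm hn), ContinuousMap.inner_toLp] at h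
  simpa using h

/-- The product of the Haar probability measures on the torus. -/
noncomputable def torusHaar (ι : Type*) [Fintype ι] :
    MeasureTheory.ProbabilityMeasure (UnitAddTorus ι) :=
  ⟨MeasureTheory.Measure.pi fun _ => AddCircle.haarAddCircle, inferInstance⟩

theorem integral_mFourier_of_ne_zero {ι : Type*} [Fintype ι] {m : ι → ℤ} (hm : m ≠ 0) :
    ∫ x, UnitAddTorus.mFourier m x ∂(torusHaar ι : MeasureTheory.Measure (UnitAddTorus ι)) = 0 := by
  obtain ⟨i, hi⟩ := Function.ne_iff.mp hm
  have h := MeasureTheory.integral_fintype_prod_eq_prod (𝕜 := ℂ) (ι := ι)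
    (μ := fun _ => (AddCircle.haarAddCircle : MeasureTheory.Measure UnitAddCircle))
    (fun i (x : UnitAddCircle) => (fourier (m i) x : ℂ))
  refine h.trans (Finset.prod_eq_zero (Finset.mem_univ i) (integral_fourier_of_ne_zero hi))

/-- The point `n • α` of the torus. -/
noncomputable def torusOrbit {ι : Type*} (α : ι → ℝ) (n : ℕ) : UnitAddTorus ι :=
  fun i => ((n * α i : ℝ) : UnitAddCircle)

theorem mFourier_torusOrbit {ι : Type*} [Fintype ι] (α : ι → ℝ) (m : ι → ℤ) (n : ℕ) :
    UnitAddTorus.mFourier m (torusOrbit α n) =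
      Complex.exp (2 * Real.pi * Complex.I * (∑ i, m i * α i : ℝ)) ^ n := by
  simp only [UnitAddTorus.mFourier, ContinuousMap.coe_mk, torusOrbit, fourier_coe_apply]
  rw [← Complex.exp_sum, ← Complex.exp_nat_mul]
  congr 1
  push_cast
  rw [Finset.mul_sum, Finset.mul_sum]
  refine Finset.sum_congr rfl fun i _ => ?_
  ring

/-- The average of `f` over the first `N` points of the orbit. -/
noncomputable def orbitAverage {ι : Type*} (α : ι → ℝ) (f : UnitAddTorus ι → ℂ) (N : ℕ) : ℂ :=
  (N : ℂ)⁻¹ * ∑ n ∈ Finset.range N, f (torusOrbit α n)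

theorem tendsto_orbitAverage_mFourier {ι : Type*} [Fintype ι] {α : ι → ℝ}
    (hα : ∀ m : ι → ℤ, m ≠ 0 → ∀ z : ℤ, ∑ i, m i * α i ≠ z) (m : ι → ℤ) :
    Tendsto (orbitAverage α (UnitAddTorus.mFourier m)) atTop
      (𝓝 (∫ x, UnitAddTorus.mFourier m x ∂(torusHaar ι : MeasureTheory.Measure _))) := by
  by_cases hm : m = 0
  · subst hm
    simp only [UnitAddTorus.mFourier_zero, ContinuousMap.one_apply, MeasureTheory.integral_const,
      MeasureTheory.probReal_univ, one_smul]
    refine tendsto_const_nhds.congr' ?_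
    filter_upwards [eventually_gt_atTop 0] with N hN
    have : (N : ℂ) ≠ 0 := by exact_mod_cast hN.ne'
    simp [orbitAverage, this]
  · rw [integral_mFourier_of_ne_zero hm]
    set q := Complex.exp (2 * Real.pi * Complex.I * (∑ i, m i * α i : ℝ)) with hq
    have hq1 : q ≠ 1 := by
      intro h
      obtain ⟨z, hz⟩ := Complex.exp_eq_one_iff.mp h
      refine hα m hm z ?_
      have h2 : (2 * Real.pi * Complex.I : ℂ) ≠ 0 := Complex.two_pi_I_ne_zero
      rw [mul_comm (z : ℂ)] at hz
      exact_mod_cast mul_left_cancel₀ h2 hz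
    have hqn : ‖q‖ = 1 := by
      rw [hq, show (2 * Real.pi * Complex.I * (∑ i, m i * α i : ℝ) : ℂ) =
        ((2 * Real.pi * ∑ i, m i * α i : ℝ) : ℂ) * Complex.I by push_cast; ring]
      exact Complex.norm_exp_ofReal_mul_I _
    -- The geometric sum is `(q ^ N - 1) / (q - 1)` with `‖q‖ = 1`, hence bounded independently of
    -- `N`.
    have hb : ∀ N, ‖orbitAverage α (UnitAddTorus.mFourier m) N‖ ≤ (2 / ‖q - 1‖) * (N : ℝ)⁻¹ := by
      intro N
      rw [orbitAverage, norm_mul, mul_comm, norm_inv, Complex.norm_natCast]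
      refine mul_le_mul_of_nonneg_right ?_ (by positivity)
      simp_rw [mFourier_torusOrbit]
      rw [← hq, geom_sum_eq hq1, norm_div]
      refine div_le_div_of_nonneg_right ((norm_sub_le _ _).trans ?_) (norm_nonneg _)
      rw [norm_pow, hqn]; norm_num
    refine squeeze_zero_norm hb ?_
    simpa using (tendsto_inv_atTop_nhds_zero_nat (𝕜 := ℝ)).const_mul (2 / ‖q - 1‖)

theorem orbitAverage_norm_le {ι : Type*} [Fintype ι] (α : ι → ℝ) (f : C(UnitAddTorus ι, ℂ))
    (N : ℕ) : ‖orbitAverage α f N‖ ≤ ‖f‖ := by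
  rw [orbitAverage, norm_mul, norm_inv, Complex.norm_natCast]
  have h : ‖∑ n ∈ Finset.range N, f (torusOrbit α n)‖ ≤ N * ‖f‖ := by
    refine (norm_sum_le _ _).trans ?_
    refine (Finset.sum_le_sum fun n _ => f.norm_coe_le_norm _).trans ?_
    simp
  rcases Nat.eq_zero_or_pos N with rfl | hN
  · simp
  · rw [inv_mul_le_iff₀ (by exact_mod_cast hN)]
    exact h

/-- **Weyl's equidistribution theorem** on the torus, for continuous functions. -/
theorem tendsto_orbitAverage {ι : Type*} [Fintype ι] {α : ι → ℝ}
    (hα : ∀ m : ι → ℤ, m ≠ 0 → ∀ z : ℤ, ∑ i, m i * α i ≠ z) (f : C(UnitAddTorus ι, ℂ)) :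
    Tendsto (orbitAverage α f) atTop
      (𝓝 (∫ x, f x ∂(torusHaar ι : MeasureTheory.Measure _))) := by
  have hint : ∀ g : C(UnitAddTorus ι, ℂ),
      MeasureTheory.Integrable g (torusHaar ι : MeasureTheory.Measure _) := fun g =>
    (MeasureTheory.integrable_const ‖g‖).mono' g.continuous.aestronglyMeasurable
      (Eventually.of_forall fun x => g.norm_coe_le_norm x)
  have hspan : ∀ g ∈ Submodule.span ℂ (Set.range (UnitAddTorus.mFourier (d := ι))),
      Tendsto (orbitAverage α g) atTop
        (𝓝 (∫ x, g x ∂(torusHaar ι : MeasureTheory.Measure _))) := by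
    intro g hg
    induction hg using Submodule.span_induction with
    | mem g hg =>
      obtain ⟨m, rfl⟩ := hg
      exact tendsto_orbitAverage_mFourier hα m
    | zero =>
      have h : orbitAverage α (0 : UnitAddTorus ι → ℂ) = 0 := by
        ext; simp [orbitAverage]
      simp only [ContinuousMap.coe_zero, h, Pi.zero_apply, MeasureTheory.integral_zero]
      exact tendsto_const_nhds
    | add g h _ _ hg hh =>
      have := hg.add hh
      rw [← MeasureTheory.integral_add (hint g) (hint h)] at this
      refine this.congr fun N => ?_
      simp [orbitAverage, Finset.sum_add_distrib, mul_add]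
    | smul c g _ hg =>
      have := hg.const_mul c
      rw [← MeasureTheory.integral_const_mul] at this
      refine this.congr fun N => ?_
      simp only [orbitAverage, ContinuousMap.smul_apply, smul_eq_mul, ← Finset.mul_sum]
      ring
  rw [Metric.tendsto_atTop]
  intro ε hε
  -- Trigonometric polynomials are dense in the uniform norm, and both the orbit average and the
  -- integral are 1-Lipschitz for it.
  have hf : f ∈ closure (Submodule.span ℂ (Set.range (UnitAddTorus.mFourier (d := ι))) :
      Set C(UnitAddTorus ι, ℂ)) := by
    have h := UnitAddTorus.span_mFourier_closure_eq_top (d := ι)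
    rw [← Submodule.topologicalClosure_coe, h]
    trivial
  obtain ⟨g, hg, hfg⟩ := Metric.mem_closure_iff.mp hf (ε / 3) (by positivity)
  obtain ⟨N₀, hN₀⟩ := Metric.tendsto_atTop.mp (hspan g hg) (ε / 3) (by positivity)
  refine ⟨N₀, fun N hN => ?_⟩
  have h1 : dist (orbitAverage α f N) (orbitAverage α g N) ≤ dist f g := by
    rw [dist_eq_norm, dist_eq_norm]
    refine le_trans (le_of_eq ?_) (orbitAverage_norm_le α (f - g) N)
    simp [orbitAverage, mul_sub]
  have h2 : dist (∫ x, g x ∂(torusHaar ι : MeasureTheory.Measure _))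
      (∫ x, f x ∂(torusHaar ι : MeasureTheory.Measure _)) ≤ dist f g := by
    rw [dist_comm, dist_eq_norm, ← MeasureTheory.integral_sub (hint f) (hint g), dist_eq_norm]
    refine (MeasureTheory.norm_integral_le_of_norm_le_const (C := ‖f - g‖)
      (Eventually.of_forall fun x => (f - g).norm_coe_le_norm x)).trans ?_
    simp
  have h3 := hN₀ N hN
  calc _ ≤ _ + _ + _ := dist_triangle4 _ (orbitAverage α g N) _ _
    _ < ε := by linarith

/-! ### Equidistribution in boxes -/

/-- The set `A` has natural density `d`, along initial segments `{0, …, N - 1}`. -/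
def HasNatDensity (A : Set ℕ) (d : ℝ) : Prop :=
  Tendsto (fun N : ℕ => (((Finset.range N : Set ℕ) ∩ A).ncard : ℝ) / N) atTop (𝓝 d)

open MeasureTheory in
/-- The uniform probability measure on the first `N + 1` points of the orbit. -/
noncomputable def orbitMeasure {ι : Type*} [Fintype ι] (α : ι → ℝ) (N : ℕ) :
    ProbabilityMeasure (UnitAddTorus ι) :=
  ⟨((N + 1 : ℕ) : ENNReal)⁻¹ • ∑ n ∈ Finset.range (N + 1), Measure.dirac (torusOrbit α n), ⟨by
    simp only [Measure.smul_apply, Measure.finsetSum_apply, measure_univ, smul_eq_mul,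
      Finset.sum_const, Finset.card_range, nsmul_eq_mul, mul_one]
    exact ENNReal.inv_mul_cancel (by simp) (ENNReal.natCast_ne_top _)⟩⟩

theorem integral_orbitMeasure {ι : Type*} [Fintype ι] (α : ι → ℝ) (N : ℕ)
    (f : C(UnitAddTorus ι, ℂ)) :
    ∫ x, f x ∂(orbitMeasure α N : MeasureTheory.Measure (UnitAddTorus ι)) =
      orbitAverage α f (N + 1) := by
  have hint : ∀ n ∈ Finset.range (N + 1),
      MeasureTheory.Integrable f (MeasureTheory.Measure.dirac (torusOrbit α n)) := fun n _ =>
    (MeasureTheory.integrable_const ‖f‖).mono' f.continuous.aestronglyMeasurable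
      (Eventually.of_forall fun x => f.norm_coe_le_norm x)
  change ∫ x, f x ∂(((N + 1 : ℕ) : ENNReal)⁻¹ • ∑ n ∈ Finset.range (N + 1),
    MeasureTheory.Measure.dirac (torusOrbit α n)) = _
  rw [MeasureTheory.integral_smul_measure, MeasureTheory.integral_finsetSum_measure hint]
  rw [ENNReal.toReal_inv, ENNReal.toReal_natCast]
  simp [orbitAverage, MeasureTheory.integral_dirac, Complex.real_smul]

theorem orbitMeasure_apply {ι : Type*} [Fintype ι] (α : ι → ℝ) (N : ℕ)
    {U : Set (UnitAddTorus ι)} (hU : MeasurableSet U) :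
    ((orbitMeasure α N : MeasureTheory.Measure (UnitAddTorus ι)) U).toReal =
      (((Finset.range (N + 1) : Set ℕ) ∩ {n | torusOrbit α n ∈ U}).ncard : ℝ) / (N + 1 : ℕ) := by
  classical
  change ((((N + 1 : ℕ) : ENNReal)⁻¹ • ∑ n ∈ Finset.range (N + 1),
    MeasureTheory.Measure.dirac (torusOrbit α n)) U).toReal = _
  have h : ((Finset.range (N + 1) : Set ℕ) ∩ {n | torusOrbit α n ∈ U}) =
      ((Finset.range (N + 1)).filter fun n => torusOrbit α n ∈ U : Finset ℕ) := by
    ext; simp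
  rw [h, Set.ncard_coe_finset, Finset.card_filter]
  simp only [MeasureTheory.Measure.smul_apply, MeasureTheory.Measure.finsetSum_apply,
    MeasureTheory.Measure.dirac_apply' _ hU, smul_eq_mul, ENNReal.toReal_mul, ENNReal.toReal_inv,
    ENNReal.toReal_natCast]
  rw [div_eq_inv_mul, ENNReal.toReal_sum]
  · push_cast
    congr 1
    refine Finset.sum_congr rfl fun n _ => ?_
    by_cases h : torusOrbit α n ∈ U <;> simp [h]
  · intro n _
    by_cases h : torusOrbit α n ∈ U <;> simp [h]

/-- Weyl's theorem rephrased as weak convergence, so that the portmanteau theorem can pass from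
continuous functions to sets with null boundary. -/
theorem tendsto_orbitMeasure {ι : Type*} [Fintype ι] {α : ι → ℝ}
    (hα : ∀ m : ι → ℤ, m ≠ 0 → ∀ z : ℤ, ∑ i, m i * α i ≠ z) :
    Tendsto (orbitMeasure α) atTop (𝓝 (torusHaar ι)) := by
  rw [MeasureTheory.ProbabilityMeasure.tendsto_iff_forall_integral_rclike_tendsto ℂ]
  intro f
  have h := (tendsto_add_atTop_iff_nat 1).mpr (tendsto_orbitAverage hα f.toContinuousMap)
  refine h.congr fun N => ?_
  exact (integral_orbitMeasure α N f.toContinuousMap).symm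

/-- The image of the open interval `(a, b)` on the circle. -/
def openArc (a b : ℝ) : Set UnitAddCircle := (fun x : ℝ => (x : UnitAddCircle)) '' Set.Ioo a b

/-- The image of the closed interval `[a, b]` on the circle. -/
def closedArc (a b : ℝ) : Set UnitAddCircle := (fun x : ℝ => (x : UnitAddCircle)) '' Set.Icc a b

theorem isOpen_openArc (a b : ℝ) : IsOpen (openArc a b) :=
  QuotientAddGroup.isOpenMap_coe _ isOpen_Ioo

theorem isClosed_closedArc (a b : ℝ) : IsClosed (closedArc a b) :=
  (isCompact_Icc.image (AddCircle.continuous_mk' 1)).isClosed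

theorem coe_mem_openArc {a b : ℝ} (ha : 0 ≤ a) (hb : b ≤ 1) (x : ℝ) :
    (x : UnitAddCircle) ∈ openArc a b ↔ Int.fract x ∈ Set.Ioo a b := by
  have hx : ((Int.fract x : ℝ) : UnitAddCircle) = x := by
    rw [Int.fract, AddCircle.coe_sub, (AddCircle.coe_eq_zero_iff (1 : ℝ) (x := (⌊x⌋ : ℝ))).mpr ⟨⌊x⌋, by simp⟩,
      sub_zero]
  constructor
  · rintro ⟨y, hy, hyx⟩
    have h : y = Int.fract x := by
      refine (AddCircle.coe_eq_coe_iff_of_mem_Ico (p := (1 : ℝ)) (a := 0) ?_ ?_).mp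
        (hyx.trans hx.symm)
      · exact ⟨ha.trans hy.1.le, by linarith [hy.2]⟩
      · exact ⟨Int.fract_nonneg x, by simpa using Int.fract_lt_one x⟩
    exact h ▸ hy
  · exact fun h => ⟨_, h, hx⟩

theorem haar_openArc {a b : ℝ} (ha : 0 ≤ a) (hb : b ≤ 1) :
    AddCircle.haarAddCircle (openArc a b) = ENNReal.ofReal (b - a) := by
  have h := (AddCircle.measurePreserving_mk 1 0).measure_preimage
    (isOpen_openArc a b).measurableSet.nullMeasurableSet
  rw [MeasureTheory.Measure.restrict_apply
    (AddCircle.measurable_mk' (isOpen_openArc a b).measurableSet),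
    AddCircle.volume_eq_smul_haarAddCircle] at h
  simp only [ENNReal.ofReal_one, one_smul] at h
  rw [← h, ← Real.volume_Ioo]
  congr 1
  ext x
  simp only [Set.mem_inter_iff, Set.mem_preimage, coe_mem_openArc ha hb, zero_add]
  constructor
  · rintro ⟨h1, h2⟩
    rcases h2.2.lt_or_eq with h3 | h3
    · rwa [Int.fract_eq_self.mpr ⟨h2.1.le, h3⟩] at h1
    · rw [h3, Int.fract_one] at h1
      exact absurd h1.1 (not_lt.mpr ha)
  · intro h1
    have h2 : 0 < x := ha.trans_lt h1.1
    have h3 : x < 1 := h1.2.trans_le hb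
    rw [Int.fract_eq_self.mpr ⟨h2.le, h3⟩]
    exact ⟨h1, h2, h3.le⟩

theorem haar_singleton (x : ℝ) : AddCircle.haarAddCircle {(x : UnitAddCircle)} = 0 := by
  have h := (AddCircle.measurePreserving_mk 1 0).measure_preimage
    (measurableSet_singleton (x : UnitAddCircle)).nullMeasurableSet
  rw [AddCircle.volume_eq_smul_haarAddCircle] at h
  simp only [ENNReal.ofReal_one, one_smul] at h
  rw [← h]
  refine le_antisymm ((MeasureTheory.Measure.restrict_apply_le _ _).trans ?_) zero_le
  refine (Set.Countable.measure_zero ?_ _).le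
  refine (Set.countable_range fun n : ℤ => x + n).mono fun y hy => ?_
  have hy' : ((y - x : ℝ) : UnitAddCircle) = 0 := by
    rw [AddCircle.coe_sub, sub_eq_zero]
    exact hy
  obtain ⟨n, hn⟩ := (AddCircle.coe_eq_zero_iff 1).mp hy'
  exact ⟨n, by simp only [zsmul_eq_mul, mul_one] at hn; simp [hn]⟩

/-- The two arcs differ at most by the end points, which are null. This makes the boundary of a box
null. -/
theorem haar_closedArc_le (a b : ℝ) :
    AddCircle.haarAddCircle (closedArc a b) ≤ AddCircle.haarAddCircle (openArc a b) := by
  have h1 : closedArc a b ⊆ openArc a b ∪ {(a : UnitAddCircle), (b : UnitAddCircle)} := by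
    rintro _ ⟨x, hx, rfl⟩
    rcases hx.1.eq_or_lt with rfl | h1
    · simp
    rcases hx.2.eq_or_lt with rfl | h2
    · simp
    exact Or.inl ⟨x, ⟨h1, h2⟩, rfl⟩
  refine (MeasureTheory.measure_mono h1).trans ((MeasureTheory.measure_union_le _ _).trans ?_)
  have h2 : AddCircle.haarAddCircle {(a : UnitAddCircle), (b : UnitAddCircle)} = 0 := by
    rw [Set.insert_eq]
    exact MeasureTheory.measure_union_null (haar_singleton a) (haar_singleton b)
  rw [h2, add_zero]

theorem openArc_subset_closedArc (a b : ℝ) : openArc a b ⊆ closedArc a b :=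
  Set.image_mono Set.Ioo_subset_Icc_self

/-- The proportion of `n` such that every `n * α i` lies, modulo one, in a prescribed interval is
the volume of the corresponding box. -/
theorem hasNatDensity_box {ι : Type*} [Fintype ι] {α : ι → ℝ}
    (hα : ∀ m : ι → ℤ, m ≠ 0 → ∀ z : ℤ, ∑ i, m i * α i ≠ z) {a b : ι → ℝ}
    (ha : ∀ i, 0 ≤ a i) (hab : ∀ i, a i ≤ b i) (hb : ∀ i, b i ≤ 1) :
    HasNatDensity {n | ∀ i, Int.fract (n * α i) ∈ Set.Ioo (a i) (b i)} (∏ i, (b i - a i)) := by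
  set O : Set (UnitAddTorus ι) := Set.pi Set.univ fun i => openArc (a i) (b i)
  set C : Set (UnitAddTorus ι) := Set.pi Set.univ fun i => closedArc (a i) (b i)
  have hO : IsOpen O := isOpen_set_pi Set.finite_univ fun i _ => isOpen_openArc _ _
  have hC : IsClosed C := isClosed_set_pi fun i _ => isClosed_closedArc _ _
  have hOC : O ⊆ C := Set.pi_mono fun i _ => openArc_subset_closedArc _ _
  have hCO : (torusHaar ι : MeasureTheory.Measure _) C ≤
      (torusHaar ι : MeasureTheory.Measure _) O := by
    change MeasureTheory.Measure.pi _ _ ≤ MeasureTheory.Measure.pi _ _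
    rw [MeasureTheory.Measure.pi_pi, MeasureTheory.Measure.pi_pi]
    exact Finset.prod_le_prod' fun i _ => haar_closedArc_le _ _
  -- The boundary of the open box lies in the closed box minus the open one, and the two have equal
  -- finite measure.
  have hfr : (torusHaar ι : MeasureTheory.Measure _) (frontier O) = 0 := by
    refine MeasureTheory.measure_mono_null (t := C \ O) ?_ ?_
    · rw [hO.frontier_eq]
      exact Set.sdiff_subset_sdiff_left (hC.closure_subset_iff.mpr hOC)
    · rw [MeasureTheory.measure_sdiff hOC hO.measurableSet.nullMeasurableSet
        (MeasureTheory.measure_ne_top _ _)]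
      exact tsub_eq_zero_of_le hCO
  have hvol : ((torusHaar ι : MeasureTheory.Measure _) O).toReal = ∏ i, (b i - a i) := by
    change (MeasureTheory.Measure.pi _ _).toReal = _
    rw [MeasureTheory.Measure.pi_pi, ENNReal.toReal_prod]
    refine Finset.prod_congr rfl fun i _ => ?_
    rw [haar_openArc (ha i) (hb i), ENNReal.toReal_ofReal (sub_nonneg.mpr (hab i))]
  have h := MeasureTheory.ProbabilityMeasure.tendsto_measure_of_null_frontier_of_tendsto'
    (tendsto_orbitMeasure hα) hfr
  have h' := (ENNReal.tendsto_toReal (MeasureTheory.measure_ne_top _ _)).comp h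
  rw [hvol] at h'
  rw [HasNatDensity, ← tendsto_add_atTop_iff_nat 1]
  refine h'.congr fun N => ?_
  rw [Function.comp_apply, orbitMeasure_apply α N hO.measurableSet]
  congr 4
  ext n
  simp only [Set.mem_ofPred_eq, O, Set.mem_pi, Set.mem_univ, true_imp_iff, torusOrbit]
  exact forall_congr' fun i => coe_mem_openArc (ha i) (hb i) _

/-! ### Linear independence of radicals -/

/-- The minimal polynomial of an irrational positive real radical has no second coefficient. -/
theorem nextCoeff_minpoly_radical {β : ℝ} (hβ : 0 < β) {k : ℕ} (hk : 0 < k) {c : ℚ}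
    (hc : β ^ k = c) (hirr : Irrational β) : (minpoly ℚ β).nextCoeff = 0 := by
  have hint : IsIntegral ℚ β := by
    refine IsIntegral.of_pow hk ?_
    rw [hc]
    exact isIntegral_algebraMap (R := ℚ) (A := ℝ) (x := c)
  have hdvd : minpoly ℚ β ∣ Polynomial.X ^ k - Polynomial.C c :=
    minpoly.dvd _ _ (by simp [hc])
  have hmonic : (minpoly ℚ β).Monic := minpoly.monic hint
  set P := minpoly ℚ β with hP
  set e := P.natDegree with he
  -- All complex roots of `P` are roots of `X ^ k - c`, so they share the modulus `β`.
  have hroots : ∀ z ∈ (P.map (algebraMap ℚ ℂ)).roots, ‖z‖ = β := by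
    intro z hz
    have h1 := Polynomial.eval_eq_zero_of_dvd_of_eval_eq_zero
      (Polynomial.map_dvd (algebraMap ℚ ℂ) hdvd) (Polynomial.isRoot_of_mem_roots hz)
    have h2 : z ^ k = c := by
      simpa [sub_eq_zero] using h1
    have h3 : ‖z‖ ^ k = β ^ k := by
      rw [← norm_pow, h2, hc]
      have : (c : ℂ) = ((c : ℝ) : ℂ) := by simp
      rw [this, Complex.norm_real, Real.norm_of_nonneg]
      rw [← hc]; positivity
    exact (pow_left_inj₀ (norm_nonneg _) hβ.le hk.ne').mp h3
  have hsplit : (P.map (algebraMap ℚ ℂ)).Splits := IsAlgClosed.splits _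
  have hcard : Multiset.card (P.map (algebraMap ℚ ℂ)).roots = e := by
    rw [← hsplit.natDegree_eq_card_roots, Polynomial.natDegree_map]
  -- The product of the roots is the constant coefficient up to sign; taking absolute values shows
  -- that `β ^ e` is rational. Then `P` divides a binomial of its own degree and equals it.
  have hprod : β ^ e = ((|P.coeff 0| : ℚ) : ℝ) := by
    have h1 := hsplit.coeff_zero_eq_prod_roots_of_monic (hmonic.map _)
    have h2 := congrArg norm h1
    rw [norm_mul, norm_pow, norm_neg, norm_one, one_pow, one_mul, Polynomial.coeff_map] at h2
    have h3 : ‖(P.map (algebraMap ℚ ℂ)).roots.prod‖ = β ^ e := by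
      rw [← hcard]
      generalize (P.map (algebraMap ℚ ℂ)).roots = s at hroots
      induction s using Multiset.induction with
      | empty => simp
      | cons a s ih =>
        rw [Multiset.prod_cons, norm_mul, hroots a (Multiset.mem_cons_self a s),
          ih fun z hz => hroots z (Multiset.mem_cons_of_mem hz), Multiset.card_cons, pow_succ']
    rw [← h3, ← h2]
    simp
  have hdeg : 2 ≤ e := by
    rw [he, hP, minpoly.two_le_natDegree_iff hint]
    rintro ⟨q, hq⟩
    exact hirr ⟨q, hq⟩
  have hdvd2 : P ∣ Polynomial.X ^ e - Polynomial.C |P.coeff 0| :=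
    minpoly.dvd _ _ (by simp [hprod])
  have heq : P = Polynomial.X ^ e - Polynomial.C |P.coeff 0| := by
    refine (Polynomial.eq_of_monic_of_dvd_of_natDegree_le hmonic
      (Polynomial.monic_X_pow_sub_C _ (by omega)) hdvd2 ?_).symm
    rw [Polynomial.natDegree_X_pow_sub_C]
  rw [Polynomial.nextCoeff_of_natDegree_pos (by omega), ← he, heq, Polynomial.coeff_sub,
    Polynomial.coeff_X_pow, Polynomial.coeff_C, if_neg (by omega), if_neg (by omega), sub_zero]

/-- Positive real radicals of rational numbers with pairwise irrational ratios are linearly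
independent over the rational numbers. -/
theorem linearIndependent_radicals {ι : Type*} {α : ι → ℝ} (hpos : ∀ i, 0 < α i) {k : ℕ}
    (hk : 0 < k) (hrat : ∀ i, ∃ c : ℚ, α i ^ k = c)
    (hirr : ∀ i j, i ≠ j → Irrational (α i / α j)) : LinearIndependent ℚ α := by
  classical
  rw [linearIndependent_iff']
  intro s g hg i₀ hi₀
  -- Dividing the relation by `α i₀` turns that term into the rational `g i₀` and every other one
  -- into a multiple of an irrational radical.
  set β : ι → ℝ := fun i => α i / α i₀ with hβ
  have hβrat : ∀ i, ∃ c : ℚ, β i ^ k = c := by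
    intro i
    obtain ⟨c, hc⟩ := hrat i
    obtain ⟨d, hd⟩ := hrat i₀
    exact ⟨c / d, by rw [hβ]; push_cast; rw [div_pow, hc, hd]⟩
  have hβint : ∀ i, IsIntegral ℚ (β i) := by
    intro i
    obtain ⟨c, hc⟩ := hβrat i
    refine IsIntegral.of_pow hk ?_
    rw [hc]
    exact isIntegral_algebraMap (R := ℚ) (A := ℝ) (x := c)
  set K := IntermediateField.adjoin ℚ (β '' (s : Set ι)) with hK
  have hfin : FiniteDimensional ℚ K := by
    have : Finite (β '' (s : Set ι)) := (s.finite_toSet.image β).to_subtype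
    refine IntermediateField.finiteDimensional_adjoin ?_
    rintro _ ⟨i, -, rfl⟩
    exact hβint i
  have hmem : ∀ i ∈ s, β i ∈ K := fun i hi =>
    IntermediateField.subset_adjoin _ _ ⟨i, hi, rfl⟩
  have hsum : ∑ i ∈ s.attach, g i • (⟨β i, hmem i i.2⟩ : K) = 0 := by
    apply Subtype.ext
    have h : ∑ i ∈ s, g i • β i = 0 := by
      have : ∑ i ∈ s, g i • β i = (∑ i ∈ s, g i • α i) / α i₀ := by
        rw [Finset.sum_div]
        exact Finset.sum_congr rfl fun i _ => by simp [hβ, Rat.smul_def, mul_div_assoc]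
      rw [this, hg, zero_div]
    rw [← Finset.sum_attach] at h
    simpa using h
  -- The trace of an element is a multiple of the second coefficient of its minimal polynomial, so
  -- only the `i₀` term survives and `g i₀ = 0`.
  have htr := congrArg (Algebra.trace ℚ K) hsum
  rw [map_sum, map_zero, Finset.sum_eq_single (⟨i₀, hi₀⟩ : s)] at htr
  · have h1 : (⟨β i₀, hmem i₀ hi₀⟩ : K) = algebraMap ℚ K 1 := by
      apply Subtype.ext
      simp [hβ, (hpos i₀).ne']
    rw [map_smul, h1, Algebra.trace_algebraMap] at htr
    have h2 : Module.finrank ℚ K ≠ 0 := Module.finrank_pos.ne'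
    simpa [h2] using htr
  · intro i _ hi
    have hi' : (i : ι) ≠ i₀ := fun h => hi (Subtype.ext h)
    obtain ⟨c, hc⟩ := hβrat i
    have h1 : minpoly ℚ (⟨β i, hmem i i.2⟩ : K) = minpoly ℚ (β i) :=
      (minpoly.algebraMap_eq (B' := ℝ) (algebraMap K ℝ).injective _).symm
    rw [map_smul, trace_eq_finrank_mul_minpoly_nextCoeff, h1,
      nextCoeff_minpoly_radical (div_pos (hpos i) (hpos i₀)) hk hc (hirr i i₀ hi')]
    simp
  · intro h
    exact absurd (Finset.mem_attach _ _) h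

/-! ### Factoring `k`-full integers through reduced ones -/

/-- The positive integers all of whose nonzero prime exponents lie strictly between `k` and
`2 * k`. Every `k`-full integer is uniquely a `k`-th power times such an integer. -/
def IsKReduced (k B : ℕ) : Prop :=
  B ≠ 0 ∧ ∀ p, B.factorization p = 0 ∨ (k < B.factorization p ∧ B.factorization p < 2 * k)

theorem isKReduced_one (k : ℕ) : IsKReduced k 1 := ⟨one_ne_zero, fun p => by simp⟩

/-- The admissible exponents `0, k + 1, …, 2 * k - 1` are pairwise incongruent modulo `k`. -/
theorem eq_of_add_mul_eq_add_mul {k u v s r : ℕ} (hu : u = 0 ∨ (k < u ∧ u < 2 * k))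
    (hv : v = 0 ∨ (k < v ∧ v < 2 * k)) (h : k * s + u = k * r + v) : u = v := by
  have hm : u % k = v % k := by
    have := congrArg (· % k) h
    simpa using this
  have key : ∀ w, (k < w ∧ w < 2 * k) → w % k = w - k := fun w hw => by
    rw [Nat.mod_eq_sub_mod hw.1.le, Nat.mod_eq_of_lt (by omega)]
  rcases hu with rfl | hu <;> rcases hv with rfl | hv
  · rfl
  · rw [key v hv] at hm; simp at hm; omega
  · rw [key u hu] at hm; simp at hm; omega
  · rw [key u hu, key v hv] at hm; omega

theorem IsKReduced.eq_of_pow_mul_eq {k B C s r : ℕ} (hB : IsKReduced k B) (hC : IsKReduced k C)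
    (hs : s ≠ 0) (hr : r ≠ 0) (h : s ^ k * B = r ^ k * C) : B = C := by
  refine Nat.eq_of_factorization_eq hB.1 hC.1 fun p => ?_
  have h1 := congrArg (fun n => n.factorization p) h
  simp only [Nat.factorization_mul (pow_ne_zero k hs) hB.1,
    Nat.factorization_mul (pow_ne_zero k hr) hC.1, Nat.factorization_pow, Finsupp.add_apply,
    Finsupp.smul_apply, smul_eq_mul] at h1
  exact eq_of_add_mul_eq_add_mul (hB.2 p) (hC.2 p) h1

theorem isKFull_iff_factorization {k n : ℕ} :
    IsKFull k n ↔ n ≠ 0 ∧ ∀ p, n.factorization p = 0 ∨ k ≤ n.factorization p := by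
  constructor
  · rintro ⟨h0, h⟩
    refine ⟨h0.ne', fun p => ?_⟩
    by_cases hp : p.Prime
    · by_cases hd : p ∣ n
      · exact Or.inr ((hp.pow_dvd_iff_le_factorization h0.ne').mp (h p hp hd))
      · exact Or.inl (Nat.factorization_eq_zero_of_not_dvd hd)
    · exact Or.inl (Nat.factorization_eq_zero_of_not_prime n hp)
  · rintro ⟨h0, h⟩
    refine ⟨Nat.pos_of_ne_zero h0, fun p hp hd => ?_⟩
    rw [hp.pow_dvd_iff_le_factorization h0]
    exact (h p).resolve_left (hp.factorization_pos_of_dvd h0 hd).ne'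

theorem IsKFull.exists_eq_pow_mul {k : ℕ} (hk : 0 < k) (n : ℕ) (hn : IsKFull k n) :
    ∃ a B, a ≠ 0 ∧ IsKReduced k B ∧ n = a ^ k * B := by
  induction n using Nat.strong_induction_on with
  | _ n ih =>
  rw [isKFull_iff_factorization] at hn
  obtain ⟨h0, hf⟩ := hn
  by_cases hr : IsKReduced k n
  · exact ⟨1, n, one_ne_zero, hr, by simp⟩
  have hr' : ∃ p, n.factorization p ≠ 0 ∧
      ¬ (k < n.factorization p ∧ n.factorization p < 2 * k) := by
    by_contra hcon
    push Not at hcon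
    refine hr ⟨h0, fun p => ?_⟩
    by_cases hp : n.factorization p = 0
    · exact Or.inl hp
    · by_contra hh
      have := hcon p hp
      omega
  obtain ⟨p, hp0, hpk⟩ := hr'
  have hp : p.Prime := by
    by_contra hp
    exact hp0 (Nat.factorization_eq_zero_of_not_prime n hp)
  have hle : k ≤ n.factorization p := (hf p).resolve_left hp0
  obtain ⟨m, hm⟩ := (hp.pow_dvd_iff_le_factorization h0).mpr hle
  have hm0 : m ≠ 0 := by rintro rfl; simp at hm; exact h0 hm
  have hfac : ∀ q, n.factorization q = (if q = p then k else 0) + m.factorization q := by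
    intro q
    rw [hm, Nat.factorization_mul (pow_ne_zero k hp.ne_zero) hm0, hp.factorization_pow,
      Finsupp.add_apply, Finsupp.single_apply]
    simp [eq_comm]
  have hlt : m < n := by
    rw [hm]
    exact lt_mul_of_one_lt_left (Nat.pos_of_ne_zero hm0) (Nat.one_lt_pow hk.ne' hp.one_lt)
  -- Removing `p ^ k` keeps the number `k`-full: the exponent of `p` was either `k` or at least `2 *
  -- k`.
  obtain ⟨a, B, ha, hB, hmB⟩ := ih m hlt (isKFull_iff_factorization.mpr ⟨hm0, fun q => by
    have h1 := hfac q
    have h2 := hf q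
    by_cases hq : q = p
    · subst hq
      simp only [if_true] at h1
      omega
    · simp only [hq, if_false] at h1
      omega⟩)
  exact ⟨p * a, B, mul_ne_zero hp.ne_zero ha, hB, by rw [hm, hmB, mul_pow, mul_assoc]⟩

theorem IsKReduced.pow_mul_mem_nonPowerKFull {k a B : ℕ} (hk : 0 < k) (hB : IsKReduced k B)
    (hB1 : B ≠ 1) (ha : a ≠ 0) : a ^ k * B ∈ nonPowerKFull k := by
  refine ⟨isKFull_iff_factorization.mpr ⟨mul_ne_zero (pow_ne_zero k ha) hB.1, fun p => ?_⟩, ?_⟩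
  · rw [Nat.factorization_mul (pow_ne_zero k ha) hB.1, Nat.factorization_pow, Finsupp.add_apply,
      Finsupp.smul_apply, smul_eq_mul]
    rcases Nat.eq_zero_or_pos (a.factorization p) with h | h
    · have := hB.2 p
      rw [h]; omega
    · exact Or.inr ((Nat.le_mul_of_pos_right k h).trans (Nat.le_add_right _ _))
  · rintro ⟨c, hc⟩
    have hc0 : c ≠ 0 := by
      rintro rfl
      rw [zero_pow hk.ne'] at hc
      exact mul_ne_zero (pow_ne_zero k ha) hB.1 hc
    exact hB1 (hB.eq_of_pow_mul_eq (isKReduced_one k) ha hc0 (by rw [hc, mul_one]))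

/-- Any prime factor occurs with exponent at least `k + 1`. The bound yields `B ^ (-1 / k) < 1 / 2`,
so two consecutive intervals of that length contain at most one integer together. -/
theorem IsKReduced.two_pow_lt {k B : ℕ} (hB : IsKReduced k B) (hB1 : B ≠ 1) : 2 ^ k < B := by
  obtain ⟨p, hp, hd⟩ := Nat.exists_prime_and_dvd hB1
  have h1 := ((hB.2 p).resolve_left (hp.factorization_pos_of_dvd hB.1 hd).ne').1
  have h2 := Nat.le_of_dvd (Nat.pos_of_ne_zero hB.1)
    ((hp.pow_dvd_iff_le_factorization hB.1).mpr h1)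
  calc 2 ^ k < 2 ^ (k + 1) := Nat.pow_lt_pow_right one_lt_two (Nat.lt_succ_self k)
    _ ≤ p ^ (k + 1) := Nat.pow_le_pow_left hp.two_le _
    _ ≤ B := h2

/-! ### From `k`-full numbers to integers in short intervals -/

/-- The real number `B ^ (-1 / k)`. -/
noncomputable def invRoot (k B : ℕ) : ℝ := (B : ℝ) ^ (-(1 / k : ℝ))

theorem invRoot_pos {k B : ℕ} (hB : B ≠ 0) : 0 < invRoot k B :=
  Real.rpow_pos_of_pos (by exact_mod_cast Nat.pos_of_ne_zero hB) _

theorem invRoot_pow {k B : ℕ} (hk : 0 < k) : invRoot k B ^ k = (B : ℝ)⁻¹ := by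
  rw [invRoot, ← Real.rpow_natCast, ← Real.rpow_mul (Nat.cast_nonneg B),
    show -(1 / (k : ℝ)) * k = -1 by field_simp, Real.rpow_neg_one]

theorem IsKReduced.invRoot_lt {k B : ℕ} (hk : 0 < k) (hB : IsKReduced k B) (hB1 : B ≠ 1) :
    invRoot k B < 1 / 2 := by
  refine lt_of_pow_lt_pow_left₀ k (by norm_num) ?_
  rw [invRoot_pow hk, one_div, inv_pow]
  refine inv_strictAnti₀ (by positivity) ?_
  exact_mod_cast hB.two_pow_lt hB1

/-- There is an integer strictly between `n * α` and `(n + 1) * α`. -/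
def HitsInteger (α : ℝ) (n : ℕ) : Prop := ∃ a : ℤ, n * α < a ∧ a < (n + 1) * α

theorem pow_mul_mem_Ioo_iff {k B : ℕ} (hk : 0 < k) (hB : B ≠ 0) (a n : ℕ) :
    a ^ k * B ∈ Set.Ioo (n ^ k) ((n + 1) ^ k) ↔
      n * invRoot k B < a ∧ a < (n + 1) * invRoot k B := by
  have hpos := invRoot_pos (k := k) hB
  have hB' : (0 : ℝ) < B := by exact_mod_cast Nat.pos_of_ne_zero hB
  have key : ∀ m : ℝ, (m * invRoot k B) ^ k = m ^ k / B := fun m => by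
    rw [mul_pow, invRoot_pow hk, div_eq_mul_inv]
  rw [Set.mem_Ioo, ← pow_lt_pow_iff_left₀ (a := (n : ℝ) * invRoot k B) (by positivity)
    (by positivity) hk.ne', ← pow_lt_pow_iff_left₀ (a := (a : ℝ)) (by positivity)
    (by positivity) hk.ne', key, key, div_lt_iff₀ hB', lt_div_iff₀ hB']
  norm_cast

/-- The reduced integers other than `1`. -/
abbrev KReduced (k : ℕ) : Type := {B : ℕ // IsKReduced k B ∧ B ≠ 1}

theorem HitsInteger.unique {α : ℝ} (hα : α < 1) {n : ℕ} {a b : ℤ}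
    (ha : n * α < a ∧ a < (n + 1) * α) (hb : n * α < b ∧ b < (n + 1) * α) : a = b := by
  have h1 : (a : ℝ) < b + 1 := by linarith
  have h2 : (b : ℝ) < a + 1 := by linarith
  have h3 : a < b + 1 := by exact_mod_cast h1
  have h4 : b < a + 1 := by exact_mod_cast h2
  omega

/-- Sending `B` to `a ^ k * B`, with `a` the integer that is hit, is a bijection: `B` is determined
by the product, and `a` by `B` because the interval has length less than `1`. -/
theorem ncard_Ioo_inter_nonPowerKFull {k : ℕ} (hk : 0 < k) (n : ℕ) :
    (Set.Ioo (n ^ k) ((n + 1) ^ k) ∩ nonPowerKFull k).ncard =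
      {B : KReduced k | HitsInteger (invRoot k B) n}.ncard := by
  have hnn : ∀ (B : KReduced k) (h : HitsInteger (invRoot k B) n),
      ((Classical.choose h).toNat : ℤ) = Classical.choose h ∧ (Classical.choose h).toNat ≠ 0 := by
    intro B h
    have h1 := (Classical.choose_spec h).1
    have h2 : (0 : ℝ) < Classical.choose h :=
      lt_of_le_of_lt (mul_nonneg (Nat.cast_nonneg n) (invRoot_pos B.2.1.1).le) h1
    have h3 : 0 < Classical.choose h := by exact_mod_cast h2
    omega
  have hspec : ∀ (B : KReduced k) (h : HitsInteger (invRoot k B) n),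
      n * invRoot k B < (Classical.choose h).toNat ∧
        (Classical.choose h).toNat < (n + 1) * invRoot k B := by
    intro B h
    have h1 := Classical.choose_spec h
    rw [← (hnn B h).1] at h1
    simpa only [Int.cast_natCast] using h1
  symm
  refine Set.ncard_congr (fun B h => (Classical.choose h).toNat ^ k * B) ?_ ?_ ?_
  · intro B h
    exact ⟨(pow_mul_mem_Ioo_iff hk B.2.1.1 _ _).mpr (hspec B h),
      B.2.1.pow_mul_mem_nonPowerKFull hk B.2.2 (hnn B h).2⟩
  · intro B C hB hC h
    exact Subtype.ext (B.2.1.eq_of_pow_mul_eq C.2.1 (hnn B hB).2 (hnn C hC).2 h)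
  · rintro N ⟨hN, hfull, hpow⟩
    obtain ⟨a, B, ha, hB, rfl⟩ := hfull.exists_eq_pow_mul hk
    have hB1 : B ≠ 1 := by rintro rfl; exact hpow ⟨a, by simp⟩
    have hab := (pow_mul_mem_Ioo_iff hk hB.1 a n).mp hN
    have hit : HitsInteger (invRoot k B) n := ⟨a, by simpa using hab⟩
    refine ⟨⟨B, hB, hB1⟩, hit, ?_⟩
    have h1 := hspec ⟨B, hB, hB1⟩ hit
    have h2 : (((Classical.choose hit).toNat : ℕ) : ℤ) = (a : ℤ) :=
      HitsInteger.unique (α := invRoot k B) (n := n)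
        (by linarith [hB.invRoot_lt hk hB1]) (by simpa only [Int.cast_natCast] using h1) (by simpa using hab)
    have h3 : (Classical.choose hit).toNat = a := by exact_mod_cast h2
    simp only [h3]

/-- A rational ratio `s / r` of two of these numbers would give `s ^ k * B = r ^ k * C`, hence `B =
C`. The index `B = 1` is kept so that the family contains the number `1`. -/
theorem linearIndependent_invRoot {k : ℕ} (hk : 0 < k) :
    LinearIndependent ℚ fun B : {B : ℕ // IsKReduced k B} => invRoot k B := by
  refine linearIndependent_radicals (fun B => invRoot_pos B.2.1) hk
    (fun B => ⟨(B : ℚ)⁻¹, by rw [invRoot_pow hk]; simp⟩) ?_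
  rintro B C hBC ⟨q, hq⟩
  refine hBC (Subtype.ext ?_)
  have hB0 : ((B : ℕ) : ℝ) ≠ 0 := by exact_mod_cast B.2.1
  have hC0 : ((C : ℕ) : ℝ) ≠ 0 := by exact_mod_cast C.2.1
  have hqpos : (0 : ℝ) < q := hq ▸ div_pos (invRoot_pos B.2.1) (invRoot_pos C.2.1)
  have hqpos' : 0 < q := by exact_mod_cast hqpos
  have h1 : (q : ℝ) ^ k = C / B := by
    rw [hq, div_pow, invRoot_pow hk, invRoot_pow hk]
    field_simp
  have hd : (q.den : ℝ) ≠ 0 := by exact_mod_cast q.den_ne_zero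
  have hnum : ((q.num.toNat : ℕ) : ℤ) = q.num := Int.toNat_of_nonneg (Rat.num_pos.mpr hqpos').le
  have hq' : (q : ℝ) = q.num.toNat / q.den := by
    rw [Rat.cast_def, ← Int.cast_natCast q.num.toNat, hnum]
  rw [hq', div_pow, div_eq_div_iff (pow_ne_zero k hd) hB0] at h1
  refine B.2.eq_of_pow_mul_eq C.2 (s := q.num.toNat) (r := q.den) ?_ q.den_ne_zero ?_
  · have := Rat.num_pos.mpr hqpos'
    omega
  · rw [mul_comm (q.den ^ k)]
    exact_mod_cast h1

/-- No nontrivial integral combination of the numbers `B ^ (-1 / k)` is an integer. -/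
theorem sum_mul_invRoot_ne_int {k : ℕ} (hk : 0 < k) (S : Finset (KReduced k)) (m : S → ℤ)
    (hm : m ≠ 0) (z : ℤ) : ∑ B, m B * invRoot k B.1 ≠ z := by
  classical
  intro h
  have hli := linearIndependent_invRoot hk
  -- The index `none` stands for `B = 1`, whose root is `1`; its coefficient `-z` moves the integer
  -- into the linear relation.
  let f : Option S → {B : ℕ // IsKReduced k B} := fun o =>
    o.elim ⟨1, isKReduced_one k⟩ fun B => ⟨B.1.1, B.1.2.1⟩
  have hf : Function.Injective f := by
    rintro (_ | B) (_ | C) h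
    · rfl
    · exact absurd (congrArg Subtype.val h).symm C.1.2.2
    · exact absurd (congrArg Subtype.val h) B.1.2.2
    · have h' : B.1.1 = C.1.1 := congrArg (fun x => x.1) h
      rw [Subtype.ext (Subtype.ext h')]
  have hli2 := Fintype.linearIndependent_iff.mp (hli.comp f hf)
    (fun o => o.elim (-z : ℚ) fun B => (m B : ℚ)) (by
      rw [Fintype.sum_option]
      simp only [Option.elim, f, Function.comp_apply, Rat.smul_def, invRoot, Nat.cast_one,
        Real.one_rpow] at h ⊢
      push_cast
      rw [h]; ring)
  apply hm
  funext B
  have := hli2 (some B)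
  simpa using this

/-! ### Convergence of the sum of the `B ^ (-1 / k)` -/

theorem isKReduced_mul {k m n : ℕ} (hmn : m.Coprime n) :
    IsKReduced k (m * n) ↔ IsKReduced k m ∧ IsKReduced k n := by
  by_cases hm : m = 0
  · simp [hm, IsKReduced]
  by_cases hn : n = 0
  · simp [hn, IsKReduced]
  have hz : ∀ p, m.factorization p = 0 ∨ n.factorization p = 0 := by
    intro p
    by_contra h
    push Not at h
    have hp : p.Prime := by
      by_contra hp
      exact h.1 (Nat.factorization_eq_zero_of_not_prime m hp)
    exact Nat.not_coprime_of_dvd_of_dvd hp.one_lt (Nat.dvd_of_factorization_pos h.1)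
      (Nat.dvd_of_factorization_pos h.2) hmn
  simp only [IsKReduced, Nat.factorization_mul hm hn, Finsupp.add_apply, ne_eq, mul_eq_zero, hm, hn,
    or_self, not_false_eq_true, true_and, ← forall_and]
  refine forall_congr' fun p => ?_
  have := hz p
  omega

theorem isKReduced_prime_pow {k p e : ℕ} (hp : p.Prime) :
    IsKReduced k (p ^ e) ↔ e = 0 ∨ (k < e ∧ e < 2 * k) := by
  constructor
  · intro h
    have := h.2 p
    rwa [hp.factorization_pow, Finsupp.single_eq_same] at this
  · intro h
    refine ⟨pow_ne_zero e hp.ne_zero, fun q => ?_⟩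
    rw [hp.factorization_pow, Finsupp.single_apply]
    split_ifs
    · exact h
    · exact Or.inl rfl

open Classical in
/-- The function `B ↦ B ^ (-1 / k)` on reduced integers, extended by zero. -/
noncomputable def reducedWeight (k B : ℕ) : ℝ := if IsKReduced k B then invRoot k B else 0

theorem reducedWeight_nonneg (k B : ℕ) : 0 ≤ reducedWeight k B := by
  rw [reducedWeight]
  split_ifs with h
  · exact (invRoot_pos h.1).le
  · exact le_rfl

theorem reducedWeight_one (k : ℕ) : reducedWeight k 1 = 1 := by
  rw [reducedWeight, if_pos (isKReduced_one k)]
  simp [invRoot]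

theorem reducedWeight_mul {k m n : ℕ} (hmn : m.Coprime n) :
    reducedWeight k (m * n) = reducedWeight k m * reducedWeight k n := by
  by_cases h : IsKReduced k m ∧ IsKReduced k n
  · rw [reducedWeight, reducedWeight, reducedWeight, if_pos ((isKReduced_mul hmn).mpr h),
      if_pos h.1, if_pos h.2, invRoot, Nat.cast_mul,
      Real.mul_rpow (Nat.cast_nonneg m) (Nat.cast_nonneg n)]
    rfl
  · rw [reducedWeight, if_neg (mt (isKReduced_mul hmn).mp h), eq_comm, mul_eq_zero]
    rcases not_and_or.mp h with h | h
    · exact Or.inl (if_neg h)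
    · exact Or.inr (if_neg h)

theorem invRoot_pow_succ {k : ℕ} (hk : 0 < k) (n : ℕ) :
    invRoot k (n ^ (k + 1)) = (n : ℝ) ^ (-(1 + 1 / k : ℝ)) := by
  have hk' : (k : ℝ) ≠ 0 := by exact_mod_cast hk.ne'
  rw [invRoot, Nat.cast_pow, ← Real.rpow_natCast, ← Real.rpow_mul (Nat.cast_nonneg n)]
  congr 1
  push_cast
  field_simp

theorem reducedWeight_prime_pow_of_le {k p e : ℕ} (hp : p.Prime) (he : 2 * k ≤ e)
    (he0 : e ≠ 0) : reducedWeight k (p ^ e) = 0 := by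
  rw [reducedWeight, if_neg]
  rw [isKReduced_prime_pow hp]
  omega

/-- A nonzero weight requires `e ≥ k + 1`, so the weight `p ^ (-e / k)` is at most `p ^ (-(k + 1) /
k)`; the exponent beyond `1` is what makes the sum over primes converge. -/
theorem reducedWeight_prime_pow_le {k p e : ℕ} (hk : 0 < k) (hp : p.Prime) (he : e ≠ 0) :
    reducedWeight k (p ^ e) ≤ (p : ℝ) ^ (-(1 + 1 / k : ℝ)) := by
  rw [reducedWeight]
  split_ifs with h
  · rw [isKReduced_prime_pow hp] at h
    rw [← invRoot_pow_succ hk]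
    have hke : k + 1 ≤ e := by omega
    refine Real.rpow_le_rpow_of_nonpos ?_ ?_ ?_
    · exact_mod_cast pow_pos hp.pos _
    · exact_mod_cast Nat.pow_le_pow_right hp.pos hke
    · have : (0 : ℝ) ≤ 1 / k := by positivity
      linarith
  · positivity

theorem tsum_reducedWeight_prime_pow_le {k p : ℕ} (hk : 0 < k) (hp : p.Prime) :
    ∑' e, reducedWeight k (p ^ e) ≤ 1 + (2 * k) * (p : ℝ) ^ (-(1 + 1 / k : ℝ)) := by
  rw [tsum_eq_sum (s := Finset.range (2 * k + 1)) (fun e he => by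
    rw [Finset.mem_range, not_lt] at he
    exact reducedWeight_prime_pow_of_le hp (by omega) (by omega)), Finset.sum_range_succ',
    pow_zero, reducedWeight_one, add_comm]
  gcongr
  refine (Finset.sum_le_sum fun e _ => reducedWeight_prime_pow_le hk hp e.succ_ne_zero).trans ?_
  simp

theorem hasSum_smoothNumbers_reducedWeight {k : ℕ} (M : ℕ) :
    HasSum (fun m : M.smoothNumbers => reducedWeight k m)
      (∏ p ∈ M.primesBelow, ∑' e, reducedWeight k (p ^ e)) := by
  refine (EulerProduct.summable_and_hasSum_smoothNumbers_prod_primesBelow_tsum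
    (f := reducedWeight k) (reducedWeight_one k) (fun h => reducedWeight_mul h) ?_ M).2
  intro p hp
  refine summable_of_ne_finset_zero (s := Finset.range (2 * k + 1)) fun e he => ?_
  rw [Finset.mem_range, not_lt] at he
  rw [reducedWeight_prime_pow_of_le hp (by omega) (by omega), norm_zero]

theorem prod_tsum_reducedWeight_le {k : ℕ} (hk : 0 < k) (M : ℕ) {u : ℕ → ℝ}
    (hu : ∀ n : ℕ, u n = (n : ℝ) ^ (-(1 + 1 / k : ℝ))) (husum : Summable u) :
    ∏ p ∈ M.primesBelow, ∑' e, reducedWeight k (p ^ e) ≤ Real.exp (∑' n, 2 * k * u n) := by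
  have hunn : ∀ n, 0 ≤ u n := fun n => hu n ▸ Real.rpow_nonneg (Nat.cast_nonneg n) _
  calc ∏ p ∈ M.primesBelow, ∑' e, reducedWeight k (p ^ e)
      ≤ ∏ p ∈ M.primesBelow, Real.exp (2 * k * u p) := by
        refine Finset.prod_le_prod (fun p _ => tsum_nonneg fun e => reducedWeight_nonneg _ _)
          fun p hp => ?_
        refine (tsum_reducedWeight_prime_pow_le hk (Nat.prime_of_mem_primesBelow hp)).trans ?_
        rw [add_comm, ← hu]
        exact Real.add_one_le_exp _
    _ = Real.exp (∑ p ∈ M.primesBelow, 2 * k * u p) := (Real.exp_sum _ _).symm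
    _ ≤ Real.exp (∑' n, 2 * k * u n) := by
        refine Real.exp_le_exp.mpr ((husum.mul_left (2 * k : ℝ)).sum_le_tsum _ fun n _ => ?_)
        have := hunn n
        positivity

/-- The nonzero terms of a finite sum are supported on `M`-smooth numbers for some `M`. There the
Euler product applies, and `1 + t ≤ exp t` bounds it independently of `M`. -/
theorem sum_reducedWeight_le {k : ℕ} (hk : 0 < k) {u : ℕ → ℝ}
    (hu : ∀ n : ℕ, u n = (n : ℝ) ^ (-(1 + 1 / k : ℝ))) (husum : Summable u) (s : Finset ℕ) :
    ∑ x ∈ s, reducedWeight k x ≤ Real.exp (∑' n, 2 * k * u n) := by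
  obtain ⟨M, hM⟩ : ∃ M, ∀ x ∈ s, x < M :=
    ⟨s.sup id + 1, fun x hx => Nat.lt_succ_of_le (Finset.le_sup (f := id) hx)⟩
  have hsub : ∀ x ∈ s, reducedWeight k x ≠ 0 → x ∈ M.smoothNumbers := by
    intro x hx h0
    have hx0 : x ≠ 0 := by
      rintro rfl
      exact h0 (if_neg fun h => h.1 rfl)
    exact Nat.mem_smoothNumbers.mpr ⟨hx0, fun p hp => (Nat.le_of_dvd (Nat.pos_of_ne_zero hx0)
      (Nat.dvd_of_mem_primeFactorsList hp)).trans_lt (hM x hx)⟩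
  have h1 := sum_le_hasSum (Finset.subtype (· ∈ M.smoothNumbers) s)
    (fun x _ => reducedWeight_nonneg k x) (hasSum_smoothNumbers_reducedWeight (k := k) M)
  have h2 : ∑ x ∈ Finset.subtype (· ∈ M.smoothNumbers) s, reducedWeight k x =
      ∑ x ∈ s, reducedWeight k x := by
    rw [Finset.sum_subtype_eq_sum_filter (f := reducedWeight k), Finset.sum_filter_of_ne hsub]
  exact h2 ▸ h1.trans (prod_tsum_reducedWeight_le hk M hu husum)

theorem summable_reducedWeight {k : ℕ} (hk : 0 < k) : Summable (reducedWeight k) := by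
  have husum : Summable fun n : ℕ => (n : ℝ) ^ (-(1 + 1 / k : ℝ)) := by
    rw [Real.summable_nat_rpow]
    have : (0 : ℝ) < 1 / k := by positivity
    linarith
  exact summable_of_sum_le (reducedWeight_nonneg k)
    (sum_reducedWeight_le hk (fun _ => rfl) husum)

theorem summable_invRoot {k : ℕ} (hk : 0 < k) :
    Summable fun B : KReduced k => invRoot k B := by
  refine ((summable_reducedWeight hk).comp_injective Subtype.val_injective).congr fun B => ?_
  rw [Function.comp_apply, reducedWeight, if_pos B.2.1]

/-! ### Generating polynomials and the finite identity -/

open Polynomial in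
/-- The generating polynomial `∏ (1 - α i + α i X)`. -/
noncomputable def hitPolynomial {ι : Type*} (α : ι → ℝ) (S : Finset ι) : ℝ[X] :=
  ∏ i ∈ S, (C (1 - α i) + C (α i) * X)

open Polynomial in
/-- The generating polynomial `∏ (1 - 2 α i + α i X + α i Y)`, where `Y` is the outer variable. -/
noncomputable def doubleHitPolynomial {ι : Type*} (α : ι → ℝ) (S : Finset ι) : ℝ[X][X] :=
  ∏ i ∈ S, (C (C (1 - 2 * α i)) + C (C (α i) * X) + C (C (α i)) * X)

-- The source of the trinomial identity: substituting `X + Y - 1` in a factor gives `1 - α + α (X +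
-- Y - 1) = 1 - 2 α + α X + α Y`.
open Polynomial in
theorem doubleHitPolynomial_eq_eval₂ {ι : Type*} (α : ι → ℝ) (S : Finset ι) :
    doubleHitPolynomial α S = (hitPolynomial α S).eval₂ (C.comp C) (X + C (X + C (-1))) := by
  rw [hitPolynomial, eval₂_finsetProd, doubleHitPolynomial]
  refine Finset.prod_congr rfl fun i _ => ?_
  simp only [eval₂_add, eval₂_mul, eval₂_C, eval₂_X, RingHom.comp_apply]
  simp only [map_sub, map_add, map_mul, map_neg, map_one, C_ofNat]
  ring

theorem multinomial_three (l m n : ℕ) :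
    Nat.multinomial Finset.univ ![l, m, n] = (l + m + n).choose m * (l + n).choose l := by
  rw [Nat.multinomial_univ_three]
  refine Nat.div_eq_of_eq_mul_left (by positivity) ?_
  have h1 := Nat.add_choose_mul_factorial_mul_factorial (l + n) m
  have h2 := Nat.add_choose_mul_factorial_mul_factorial n l
  rw [show l + n + m = l + m + n by ring] at h1
  rw [show n + l = l + n by ring] at h2
  rw [← h1, ← h2]
  ring

open Polynomial in
theorem hasSum_coeff_hitPolynomial {ι : Type*} (α : ι → ℝ) (S : Finset ι) (l m : ℕ) :
    HasSum (fun n : ℕ => (-1 : ℝ) ^ n * (Nat.multinomial Finset.univ ![l, m, n] : ℝ) *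
      (hitPolynomial α S).coeff (l + m + n)) (((doubleHitPolynomial α S).coeff m).coeff l) := by
  set F := hitPolynomial α S with hF
  set K := F.natDegree + 1
  have h1 : ((doubleHitPolynomial α S).coeff m).coeff l = ∑ n ∈ Finset.range K,
      (-1 : ℝ) ^ n * (Nat.multinomial Finset.univ ![l, m, n] : ℝ) * F.coeff (l + m + n) := by
    have hterm : ∀ j, ((C.comp C (F.coeff j) * (X + C (X + C (-1 : ℝ))) ^ j).coeff m).coeff l =
        F.coeff j * ((-1) ^ (j - m - l) * (j - m).choose l * j.choose m) := by
      intro j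
      rw [RingHom.comp_apply, coeff_C_mul, coeff_C_mul, coeff_X_add_C_pow, ← C_eq_natCast,
        coeff_mul_C, coeff_X_add_C_pow]
    -- Powers `j < l + m` do not contribute, so the range is taken of length `(l + m) + K` and its
    -- initial segment split off.
    rw [doubleHitPolynomial_eq_eval₂,
      eval₂_eq_sum_range' (C.comp C) (show F.natDegree < (l + m) + K by omega),
      finsetSum_coeff, finsetSum_coeff, Finset.sum_range_add]
    simp only [hterm]
    rw [Finset.sum_eq_zero, zero_add]
    · refine Finset.sum_congr rfl fun n _ => ?_
      rw [multinomial_three, show l + m + n - m - l = n by omega,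
        show l + m + n - m = l + n by omega]
      push_cast
      ring
    · intro j hj
      rw [Finset.mem_range] at hj
      by_cases hjm : j < m
      · rw [Nat.choose_eq_zero_of_lt hjm]; simp
      · rw [Nat.choose_eq_zero_of_lt (show j - m < l by omega)]; simp
  rw [h1]
  refine hasSum_sum_of_ne_finset_zero fun n hn => ?_
  rw [Finset.mem_range, not_lt] at hn
  rw [coeff_eq_zero_of_natDegree_lt (show F.natDegree < l + m + n by omega), mul_zero]

theorem pow_succ_add_mul_le {A a : ℝ} (hA : 0 ≤ A) (ha : 0 ≤ a) (j : ℕ) :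
    A ^ (j + 1) + (j + 1) * A ^ j * a ≤ (a + A) ^ (j + 1) := by
  induction j with
  | zero => simp [add_comm]
  | succ j ih =>
    calc _ ≤ (A ^ (j + 1) + (j + 1) * A ^ j * a) * (a + A) := by
          have : 0 ≤ (j + 1) * A ^ j * (a * a) := by positivity
          push_cast
          linear_combination this
      _ ≤ (a + A) ^ (j + 1) * (a + A) := by gcongr
      _ = _ := (pow_succ _ _).symm

-- The induction adds one factor at a time and compares with the first two terms of the binomial
-- expansion of `(α i + A) ^ (j + 1)`. The bound depends on `S` only through the sum of the `α i`,
-- which makes it a dominating function later.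
open Polynomial in
theorem coeff_hitPolynomial_bounds {ι : Type*} {α : ι → ℝ} (h0 : ∀ i, 0 ≤ α i)
    (h1 : ∀ i, α i ≤ 1) (S : Finset ι) (j : ℕ) :
    0 ≤ (hitPolynomial α S).coeff j ∧
      (hitPolynomial α S).coeff j ≤ (∑ i ∈ S, α i) ^ j / (j.factorial : ℝ) := by
  classical
  induction S using Finset.induction generalizing j with
  | empty =>
    rw [hitPolynomial, Finset.prod_empty, Finset.sum_empty, coeff_one]
    rcases j with _ | j <;> simp
  | insert i S hi ih =>
    have hrec : hitPolynomial α (insert i S) =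
        C (1 - α i) * hitPolynomial α S + C (α i) * (hitPolynomial α S * X) := by
      rw [hitPolynomial, Finset.prod_insert hi, hitPolynomial]
      ring
    have hA : 0 ≤ ∑ i ∈ S, α i := Finset.sum_nonneg fun i _ => h0 i
    have hi0 := h0 i
    have hi1 := sub_nonneg.mpr (h1 i)
    rw [hrec, coeff_add, coeff_C_mul, coeff_C_mul, Finset.sum_insert hi]
    rcases j with _ | j
    · rw [coeff_mul_X_zero]
      have := ih 0
      simp only [pow_zero, Nat.factorial_zero, Nat.cast_one, div_one, mul_zero, add_zero] at this ⊢
      exact ⟨mul_nonneg hi1 this.1, mul_le_one₀ (by linarith) this.1 this.2⟩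
    · rw [coeff_mul_X]
      obtain ⟨a0, a1⟩ := ih (j + 1)
      obtain ⟨b0, b1⟩ := ih j
      refine ⟨by positivity, ?_⟩
      have hf : ((j + 1).factorial : ℝ) = (j + 1) * j.factorial := by
        rw [Nat.factorial_succ]; push_cast; rfl
      set A := ∑ i ∈ S, α i
      have hpow := pow_succ_add_mul_le hA hi0 j
      calc _ ≤ 1 * (A ^ (j + 1) / ((j + 1).factorial : ℝ)) + α i * (A ^ j / j.factorial) := by
            refine add_le_add (mul_le_mul (by linarith) a1 a0 zero_le_one)
              (mul_le_mul_of_nonneg_left b1 hi0)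
        _ = (A ^ (j + 1) + (j + 1) * A ^ j * α i) / ((j + 1).factorial : ℝ) := by
            rw [hf]; field_simp
        _ ≤ _ := by gcongr

/-- The probabilities of the three states of an interval and its successor. -/
noncomputable def stateWeight (a : ℝ) : Fin 3 → ℝ := ![1 - 2 * a, a, a]

-- Expanding the product sums over all assignments of states. With indeterminates for `v`, the
-- exponents record how often each state occurs.
open Polynomial in
theorem prod_sum_stateWeight {ι R : Type*} [DecidableEq ι] [CommRing R] [Algebra ℝ R] (α : ι → ℝ) (S : Finset ι)
    (v : Fin 3 → R) :
    ∏ i ∈ S, ∑ s, algebraMap ℝ R (stateWeight (α i) s) * v s =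
      ∑ σ : S → Fin 3, algebraMap ℝ R (∏ i, stateWeight (α i.1) (σ i)) *
        (v 0 ^ (Finset.univ.filter fun i => σ i = 0).card *
          v 1 ^ (Finset.univ.filter fun i => σ i = 1).card *
          v 2 ^ (Finset.univ.filter fun i => σ i = 2).card) := by
  rw [← Finset.prod_coe_sort, Finset.prod_univ_sum, Fintype.piFinset_univ]
  refine Finset.sum_congr rfl fun σ _ => ?_
  rw [Finset.prod_mul_distrib, map_prod, ← Finset.prod_fiberwise' Finset.univ σ v,
    Fin.prod_univ_three]
  simp only [Finset.prod_const]

open Polynomial in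
theorem coeff_hitPolynomial_eq_sum {ι : Type*} [DecidableEq ι] (α : ι → ℝ) (S : Finset ι) (j : ℕ) :
    (hitPolynomial α S).coeff j =
      ∑ σ : S → Fin 3 with (Finset.univ.filter fun i => σ i = 1).card = j,
        ∏ i, stateWeight (α i.1) (σ i) := by
  have h := prod_sum_stateWeight (R := ℝ[X]) α S ![1, X, 1]
  have h2 : ∏ i ∈ S, ∑ s, algebraMap ℝ ℝ[X] (stateWeight (α i) s) * (![1, X, 1] : Fin 3 → ℝ[X]) s =
      hitPolynomial α S := by
    refine Finset.prod_congr rfl fun i _ => ?_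
    simp [Fin.sum_univ_three, stateWeight, C_ofNat]
    ring
  rw [← h2, h, finsetSum_coeff, Finset.sum_filter]
  refine Finset.sum_congr rfl fun σ _ => ?_
  simp only [algebraMap_eq, coeff_C_mul]
  simp [coeff_X_pow, eq_comm]

open Polynomial in
theorem coeff_doubleHitPolynomial_eq_sum {ι : Type*} [DecidableEq ι] (α : ι → ℝ) (S : Finset ι) (l m : ℕ) :
    ((doubleHitPolynomial α S).coeff m).coeff l =
      ∑ σ : S → Fin 3 with (Finset.univ.filter fun i => σ i = 1).card = l ∧
        (Finset.univ.filter fun i => σ i = 2).card = m, ∏ i, stateWeight (α i.1) (σ i) := by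
  have h := prod_sum_stateWeight (R := ℝ[X][X]) α S ![1, C X, X]
  have h2 : ∏ i ∈ S, ∑ s, algebraMap ℝ ℝ[X][X] (stateWeight (α i) s) *
      (![1, C X, X] : Fin 3 → ℝ[X][X]) s = doubleHitPolynomial α S := by
    refine Finset.prod_congr rfl fun i _ => ?_
    simp [Fin.sum_univ_three, stateWeight, Polynomial.algebraMap_apply, C_ofNat]
  rw [← h2, h, finsetSum_coeff, finsetSum_coeff, Finset.sum_filter]
  refine Finset.sum_congr rfl fun σ _ => ?_
  simp only [Polynomial.algebraMap_apply, algebraMap_eq, coeff_C_mul]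
  simp only [Matrix.cons_val_zero, Matrix.cons_val_one, Matrix.cons_val, one_pow, one_mul,
    ← C_pow, coeff_C_mul, coeff_X_pow]
  generalize (Finset.univ.filter fun i => σ i = 1).card = a
  generalize (Finset.univ.filter fun i => σ i = 2).card = b
  by_cases hm : m = b
  · by_cases hl : l = a
    · simp [hm, hl]
    · simp [hm, hl, coeff_X_pow, Ne.symm hl]
  · simp [hm, Ne.symm hm]

/-! ### Calculus of natural densities -/

theorem natCast_ncard_inter_eq_sum (A : Set ℕ) (N : ℕ) :
    (((Finset.range N : Set ℕ) ∩ A).ncard : ℝ) =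
      ∑ n ∈ Finset.range N, A.indicator (1 : ℕ → ℝ) n := by
  classical
  have h : ((Finset.range N : Set ℕ) ∩ A) = ((Finset.range N).filter (· ∈ A) : Finset ℕ) := by
    ext; simp
  rw [h, Set.ncard_coe_finset, Finset.card_filter]
  push_cast
  exact Finset.sum_congr rfl fun n _ => by simp [Set.indicator_apply]

theorem abs_ncard_inter_sub_le {A B E : Set ℕ} (h : ∀ n ∉ E, n ∈ A ↔ n ∈ B) (N : ℕ) :
    |(((Finset.range N : Set ℕ) ∩ A).ncard : ℝ) - ((Finset.range N : Set ℕ) ∩ B).ncard| ≤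
      ∑ n ∈ Finset.range N, E.indicator (1 : ℕ → ℝ) n := by
  rw [natCast_ncard_inter_eq_sum, natCast_ncard_inter_eq_sum, ← Finset.sum_sub_distrib]
  refine (Finset.abs_sum_le_sum_abs _ _).trans (Finset.sum_le_sum fun n _ => ?_)
  by_cases hE : n ∈ E
  · by_cases hA : n ∈ A <;> by_cases hB : n ∈ B <;> simp [hE, hA, hB]
  · have := h n hE
    by_cases hB : n ∈ B
    · simp [hE, hB, this.mpr hB]
    · simp [hE, hB, mt this.mp hB]

/-- The integer `0` must be exempted because `0 * α` sits at an end point of the arcs; it changes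
the proportion by at most `1 / N`. -/
theorem HasNatDensity.congr_pos {A B : Set ℕ} {d : ℝ} (h : ∀ n, 0 < n → (n ∈ A ↔ n ∈ B))
    (hA : HasNatDensity A d) : HasNatDensity B d := by
  have hdiff : Tendsto (fun N : ℕ => (((Finset.range N : Set ℕ) ∩ B).ncard : ℝ) / N -
      (((Finset.range N : Set ℕ) ∩ A).ncard : ℝ) / N) atTop (𝓝 0) := by
    refine squeeze_zero_norm (a := fun N : ℕ => (N : ℝ)⁻¹) (fun N => ?_)
      tendsto_inv_atTop_nhds_zero_nat
    rw [← sub_div, norm_div, Real.norm_natCast, Real.norm_eq_abs, div_eq_mul_inv]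
    refine mul_le_of_le_one_left (by positivity) ?_
    refine (abs_ncard_inter_sub_le (E := {0})
      (fun n hn => (h n (Nat.pos_of_ne_zero hn)).symm) N).trans ?_
    rw [← natCast_ncard_inter_eq_sum]
    exact_mod_cast (Set.ncard_le_ncard Set.inter_subset_right).trans (Set.ncard_singleton 0).le
  have := hdiff.add hA
  rw [zero_add] at this
  exact this.congr fun N => by ring

theorem HasNatDensity.of_fibers {κ : Type*} [Fintype κ] [DecidableEq κ] {f : ℕ → κ} {d : κ → ℝ}
    (h : ∀ s, HasNatDensity {n | f n = s} (d s)) (W : κ → Prop) [DecidablePred W] :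
    HasNatDensity {n | W (f n)} (∑ s with W s, d s) := by
  refine (tendsto_finsetSum _ fun s _ => h s).congr fun N => ?_
  rw [← Finset.sum_div]
  congr 1
  simp only [natCast_ncard_inter_eq_sum]
  rw [Finset.sum_comm]
  refine Finset.sum_congr rfl fun n _ => ?_
  simp [Set.indicator_apply, Finset.sum_ite_eq]

/-! ### States of a pair of consecutive intervals -/

open Classical in
/-- The state of the pair of intervals `(n α, (n + 1) α)`, `((n + 1) α, (n + 2) α)`: it is `1` if
the first contains an integer, `2` if only the second does, and `0` otherwise. -/
noncomputable def hitState (α : ℝ) (n : ℕ) : Fin 3 :=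
  if HitsInteger α n then 1 else if HitsInteger α (n + 1) then 2 else 0

/-- The least integer beyond `n α` is `⌊n α⌋ + 1`, so it alone has to be tested. -/
theorem hitsInteger_iff (α : ℝ) (n : ℕ) :
    HitsInteger α n ↔ 1 - α < Int.fract (n * α) := by
  have hf := Int.floor_add_fract (n * α)
  constructor
  · rintro ⟨a, h1, h3⟩
    have h4 : ⌊(n : ℝ) * α⌋ + 1 ≤ a := Int.floor_lt.mpr h1
    have h5 : ((⌊(n : ℝ) * α⌋ : ℝ)) + 1 ≤ a := by exact_mod_cast h4
    linarith
  · intro h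
    refine ⟨⌊(n : ℝ) * α⌋ + 1, ?_, ?_⟩
    · push_cast
      linarith [Int.fract_lt_one ((n : ℝ) * α)]
    · push_cast
      linarith

theorem hitsInteger_succ_iff {α : ℝ} (h2 : α < 1 / 2) (n : ℕ) :
    HitsInteger α (n + 1) ↔ Int.fract (n * α) ∈ Set.Ioo (1 - 2 * α) (1 - α) := by
  have hf := Int.floor_add_fract (n * α)
  constructor
  · rintro ⟨a, h1, h3⟩
    push_cast at h1 h3
    have h4 : ⌊(n : ℝ) * α⌋ + 1 ≤ a := Int.floor_lt.mpr (by linarith)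
    have h5 : a < ⌊(n : ℝ) * α⌋ + 2 := by
      have : (a : ℝ) < ⌊(n : ℝ) * α⌋ + 2 := by linarith [Int.fract_lt_one ((n : ℝ) * α)]
      exact_mod_cast this
    have h6 : a = ⌊(n : ℝ) * α⌋ + 1 := by omega
    rw [h6] at h1 h3
    push_cast at h1 h3
    constructor <;> linarith
  · rintro ⟨h1, h3⟩
    refine ⟨⌊(n : ℝ) * α⌋ + 1, ?_, ?_⟩ <;> push_cast <;> linarith

/-- The lower end points of the arcs describing the three states. -/
noncomputable def stateLower (a : ℝ) : Fin 3 → ℝ := ![0, 1 - a, 1 - 2 * a]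

/-- The upper end points of the arcs describing the three states. -/
noncomputable def stateUpper (a : ℝ) : Fin 3 → ℝ := ![1 - 2 * a, 1, 1 - a]

theorem stateUpper_sub_stateLower (a : ℝ) (s : Fin 3) :
    stateUpper a s - stateLower a s = stateWeight a s := by
  fin_cases s <;> simp [stateUpper, stateLower, stateWeight]; ring

theorem hitState_eq_iff {α : ℝ} (h2 : α < 1 / 2)
    (hirr : ∀ c : ℤ, c ≠ 0 → ∀ z : ℤ, c * α ≠ z) {n : ℕ} (hn : 0 < n) (s : Fin 3) :
    hitState α n = s ↔ Int.fract (n * α) ∈ Set.Ioo (stateLower α s) (stateUpper α s) := by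
  have hf := Int.floor_add_fract (n * α)
  -- The fractional part avoids the arc end points `0`, `1 - α`, `1 - 2 α` (`c = 0, 1, 2`): equality
  -- would make `(n + c) α` an integer. Hence the open arcs cover all cases.
  have hne : ∀ c : ℕ, Int.fract (n * α) ≠ (if c = 0 then 0 else 1) - c * α := by
    intro c hc
    refine hirr (n + c) (by omega) (⌊(n : ℝ) * α⌋ + if c = 0 then 0 else 1) ?_
    push_cast
    linear_combination hc - hf
  have hne0 := hne 0
  have hne1 := hne 1
  have hne2 := hne 2
  simp only [if_true, Nat.cast_zero, zero_mul, sub_zero, one_ne_zero, if_false, Nat.cast_one,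
    one_mul, OfNat.ofNat_ne_zero, Nat.cast_ofNat] at hne0 hne1 hne2
  have hlt := Int.fract_lt_one ((n : ℝ) * α)
  have hnn := Int.fract_nonneg ((n : ℝ) * α)
  have hpos := lt_of_le_of_ne hnn hne0.symm
  rw [hitState, hitsInteger_iff, hitsInteger_succ_iff h2]
  set t := Int.fract ((n : ℝ) * α)
  rcases lt_or_gt_of_ne hne1 with h1 | h1
  · rw [if_neg (not_lt.mpr h1.le)]
    rcases lt_or_gt_of_ne hne2 with h3 | h3
    · rw [if_neg (fun h => not_lt.mpr h3.le h.1)]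
      fin_cases s <;> simp [stateLower, stateUpper, hpos, h3, h1.le, h3.le]
    · rw [if_pos ⟨h3, h1⟩]
      fin_cases s <;> simp [stateLower, stateUpper, h3, h1, h1.le, h3.le]
  · rw [if_pos h1]
    have h3 : 1 - 2 * α < t := by linarith
    fin_cases s <;> simp [stateLower, stateUpper, hlt, h1, h1.le, h3.le]

/-! ### Densities for finite subsystems -/

/-- Parameters in `(0, 1 / 2)` with finite sum which together with `1` are linearly independent
over the rational numbers. -/
structure IsIndependentSystem {ι : Type*} (α : ι → ℝ) : Prop where
  pos : ∀ i, 0 < α i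
  lt_half : ∀ i, α i < 1 / 2
  summable : Summable α
  indep : ∀ (S : Finset ι) (m : S → ℤ), m ≠ 0 → ∀ z : ℤ, ∑ i, m i * α i.1 ≠ z

theorem IsIndependentSystem.mul_ne_int {ι : Type*} {α : ι → ℝ} (h : IsIndependentSystem α) (i : ι)
    (c : ℤ) (hc : c ≠ 0) (z : ℤ) : c * α i ≠ z := by
  have h1 := h.indep {i} (fun _ => c) (fun h => hc (congrFun h ⟨i, by simp⟩)) z
  rwa [Finset.sum_coe_sort {i} (fun j => (c : ℝ) * α j), Finset.sum_singleton] at h1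

theorem IsIndependentSystem.hasNatDensity_state {ι : Type*} {α : ι → ℝ}
    (h : IsIndependentSystem α) (S : Finset ι) (σ : S → Fin 3) :
    HasNatDensity {n | (fun i : S => hitState (α i) n) = σ} (∏ i, stateWeight (α i.1) (σ i)) := by
  have h1 := hasNatDensity_box (h.indep S) (a := fun i => stateLower (α i.1) (σ i))
    (b := fun i => stateUpper (α i.1) (σ i)) ?_ ?_ ?_
  · simp only [stateUpper_sub_stateLower] at h1
    refine h1.congr_pos fun n hn => ?_
    simp only [Set.mem_ofPred_eq, funext_iff]
    exact forall_congr' fun i =>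
      (hitState_eq_iff (h.lt_half i) (h.mul_ne_int i) hn (σ i)).symm
  · intro i
    have := h.pos i
    have := h.lt_half i
    generalize σ i = s
    fin_cases s <;> simp [stateLower] <;> linarith
  · intro i
    have := h.pos i
    have := h.lt_half i
    rw [← sub_nonneg, stateUpper_sub_stateLower]
    generalize σ i = s
    fin_cases s <;> simp [stateWeight] <;> linarith
  · intro i
    have := h.pos i
    have := h.lt_half i
    generalize σ i = s
    fin_cases s <;> simp [stateUpper] <;> linarith

/-- The number of `i ∈ S` for which the pair of intervals starting at `n` is in the state `s`. -/
noncomputable def stateCount {ι : Type*} (α : ι → ℝ) (S : Finset ι) (s : Fin 3) (n : ℕ) : ℕ :=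
  (Finset.univ.filter fun i : S => hitState (α i) n = s).card

theorem IsIndependentSystem.hasNatDensity_stateCount {ι : Type*} {α : ι → ℝ}
    (h : IsIndependentSystem α) (S : Finset ι) (j : ℕ) :
    HasNatDensity {n | stateCount α S 1 n = j} ((hitPolynomial α S).coeff j) := by
  classical
  rw [coeff_hitPolynomial_eq_sum]
  exact HasNatDensity.of_fibers (h.hasNatDensity_state S)
    fun σ => (Finset.univ.filter fun i => σ i = 1).card = j

theorem IsIndependentSystem.hasNatDensity_stateCount_two {ι : Type*} {α : ι → ℝ}
    (h : IsIndependentSystem α) (S : Finset ι) (l m : ℕ) :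
    HasNatDensity {n | stateCount α S 1 n = l ∧ stateCount α S 2 n = m}
      (((doubleHitPolynomial α S).coeff m).coeff l) := by
  classical
  rw [coeff_doubleHitPolynomial_eq_sum]
  exact HasNatDensity.of_fibers (h.hasNatDensity_state S) fun σ =>
    (Finset.univ.filter fun i => σ i = 1).card = l ∧ (Finset.univ.filter fun i => σ i = 2).card = m

/-! ### Passage to the infinite system -/

/-- The positive `n` for which exactly `j` of the intervals `(n α i, (n + 1) α i)` contain an
integer. -/
def hitSet {ι : Type*} (α : ι → ℝ) (j : ℕ) : Set ℕ :=
  {n | 0 < n ∧ {i | HitsInteger (α i) n}.ncard = j}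

/-- The positive `n` for which exactly `l` of the intervals `(n α i, (n + 1) α i)` and exactly `m`
of the intervals `((n + 1) α i, (n + 2) α i)` contain an integer. -/
def doubleHitSet {ι : Type*} (α : ι → ℝ) (l m : ℕ) : Set ℕ :=
  {n | 0 < n ∧ {i | HitsInteger (α i) n}.ncard = l ∧ {i | HitsInteger (α i) (n + 1)}.ncard = m}

/-- The integers at which truncation of the system to `S` may change the counts. -/
def tailSet {ι : Type*} (α : ι → ℝ) (S : Finset ι) : Set ℕ :=
  {n | n = 0 ∨ ∃ i ∉ S, HitsInteger (α i) n ∨ HitsInteger (α i) (n + 1)}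

theorem hitState_eq_one_iff {α : ℝ} {n : ℕ} : hitState α n = 1 ↔ HitsInteger α n := by
  rw [hitState]
  split_ifs <;> simp_all

theorem hitState_eq_two_iff {α : ℝ} (h2 : α < 1 / 2) {n : ℕ} :
    hitState α n = 2 ↔ HitsInteger α (n + 1) := by
  have hd : HitsInteger α (n + 1) → ¬ HitsInteger α n := by
    rw [hitsInteger_iff α n, hitsInteger_succ_iff h2]
    exact fun h => not_lt.mpr h.2.le
  rw [hitState]
  split_ifs <;> simp_all

theorem ncard_eq_stateCount {ι : Type*} {α : ι → ℝ} {S : Finset ι} {s : Fin 3} {n : ℕ}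
    {P : ι → Prop} (hP : ∀ i, hitState (α i) n = s ↔ P i) (hS : ∀ i ∉ S, ¬ P i) :
    {i | P i}.ncard = stateCount α S s n := by
  classical
  rw [stateCount, ← Finset.card_map (Function.Embedding.subtype (· ∈ S)), ← Set.ncard_coe_finset]
  congr 1
  ext i
  simp only [Set.mem_ofPred_eq, Finset.coe_map, Finset.coe_filter, Finset.mem_univ, true_and,
    Set.mem_image, hP]
  constructor
  · intro h
    have hi : i ∈ S := by
      by_contra hi
      exact hS i hi h
    exact ⟨⟨i, hi⟩, h, rfl⟩
  · rintro ⟨j, hj, rfl⟩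
    exact hj

theorem ncard_hits_eq_stateCount {ι : Type*} {α : ι → ℝ} {S : Finset ι} {n : ℕ}
    (hn : n ∉ tailSet α S) : {i | HitsInteger (α i) n}.ncard = stateCount α S 1 n :=
  ncard_eq_stateCount (fun _ => hitState_eq_one_iff)
    fun i hi h => hn (Or.inr ⟨i, hi, Or.inl h⟩)

theorem ncard_hits_succ_eq_stateCount {ι : Type*} {α : ι → ℝ} (h2 : ∀ i, α i < 1 / 2)
    {S : Finset ι} {n : ℕ} (hn : n ∉ tailSet α S) :
    {i | HitsInteger (α i) (n + 1)}.ncard = stateCount α S 2 n :=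
  ncard_eq_stateCount (fun i => hitState_eq_two_iff (h2 i))
    fun i hi h => hn (Or.inr ⟨i, hi, Or.inr h⟩)

/-- The floor differences telescope, so the number of hits below `N` is at most `N α` with no
additive error. Such an error would be fatal when summing over infinitely many parameters. -/
theorem indicator_hitsInteger_le {α : ℝ} (h0 : 0 < α) (n : ℕ) :
    {n | HitsInteger α n}.indicator (1 : ℕ → ℝ) n ≤
      (⌊((n + 1 : ℕ) : ℝ) * α⌋ : ℝ) - ⌊(n : ℝ) * α⌋ := by
  by_cases h : HitsInteger α n
  · rw [Set.indicator_of_mem (show n ∈ {n | HitsInteger α n} from h)]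
    obtain ⟨a, h1, h3⟩ := h
    have h4 : ⌊(n : ℝ) * α⌋ + 1 ≤ a := Int.floor_lt.mpr h1
    have h5 : a ≤ ⌊((n + 1 : ℕ) : ℝ) * α⌋ := Int.le_floor.mpr (by push_cast; exact h3.le)
    have h6 : ⌊(n : ℝ) * α⌋ + 1 ≤ ⌊((n + 1 : ℕ) : ℝ) * α⌋ := h4.trans h5
    have h7 : (⌊(n : ℝ) * α⌋ : ℝ) + 1 ≤ ⌊((n + 1 : ℕ) : ℝ) * α⌋ := by exact_mod_cast h6
    simp only [Pi.one_apply]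
    linarith
  · rw [Set.indicator_of_notMem (show n ∉ {n | HitsInteger α n} from h), sub_nonneg]
    have : ⌊(n : ℝ) * α⌋ ≤ ⌊((n + 1 : ℕ) : ℝ) * α⌋ := Int.floor_mono (by gcongr; simp)
    exact_mod_cast this

theorem sum_indicator_hitsInteger_le {α : ℝ} (h0 : 0 < α) (N : ℕ) :
    ∑ n ∈ Finset.range N, {n | HitsInteger α n}.indicator (1 : ℕ → ℝ) n ≤ N * α := by
  refine (Finset.sum_le_sum fun n _ => indicator_hitsInteger_le h0 n).trans ?_
  rw [Finset.sum_range_sub fun n : ℕ => (⌊(n : ℝ) * α⌋ : ℝ)]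
  simp [Int.floor_le]

theorem sum_indicator_hitsInteger_succ_le {α : ℝ} (h0 : 0 < α) (N : ℕ) :
    ∑ n ∈ Finset.range N, {n | HitsInteger α n}.indicator (1 : ℕ → ℝ) (n + 1) ≤ (N + 1) * α := by
  have h := sum_indicator_hitsInteger_le h0 (N + 1)
  rw [Finset.sum_range_succ'] at h
  push_cast at h
  refine le_trans ?_ h
  exact le_add_of_nonneg_right (Set.indicator_nonneg (fun _ _ => zero_le_one) _)

theorem HitsInteger.one_lt {α : ℝ} (h0 : 0 < α) {n : ℕ} (h : HitsInteger α n) :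
    1 < (n + 1) * α := by
  obtain ⟨a, h1, h2⟩ := h
  have h3 : (0 : ℝ) < a := lt_of_le_of_lt (by positivity) h1
  have h4 : 0 < a := by exact_mod_cast h3
  have h5 : (1 : ℝ) ≤ a := by exact_mod_cast h4
  linarith

theorem sum_indicator_tailSet_le {ι : Type*} {α : ι → ℝ} (h0 : ∀ i, 0 < α i) (hs : Summable α)
    (S : Finset ι) (N : ℕ) :
    ∑ n ∈ Finset.range N, (tailSet α S).indicator (1 : ℕ → ℝ) n ≤
      1 + (2 * N + 1) * (∑' i, α i - ∑ i ∈ S, α i) := by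
  classical
  -- For `n < N` a hit at `n` or `n + 1` forces `(N + 1) α i > 1`, which leaves finitely many
  -- indices.
  have hfin : {i | ¬ α i < 1 / (N + 1 : ℝ)}.Finite := by
    have := hs.tendsto_cofinite_zero.eventually_lt_const (show (0 : ℝ) < 1 / (N + 1) by positivity)
    exact this
  set Q := hfin.toFinset \ S with hQ
  have hQmem : ∀ n < N, ∀ i ∉ S, HitsInteger (α i) n ∨ HitsInteger (α i) (n + 1) → i ∈ Q := by
    intro n hn i hi h
    simp only [hQ, Finset.mem_sdiff, Set.Finite.mem_toFinset, Set.mem_ofPred_eq, not_lt, hi,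
      not_false_eq_true, and_true]
    rw [div_le_iff₀ (by positivity)]
    have hnN : (n : ℝ) + 1 ≤ N := by exact_mod_cast hn
    have := h0 i
    rcases h with h | h
    · have := h.one_lt (h0 i)
      nlinarith
    · have := h.one_lt (h0 i)
      push_cast at this
      nlinarith
  have hpt : ∀ n ∈ Finset.range N, (tailSet α S).indicator (1 : ℕ → ℝ) n ≤
      ({0} : Set ℕ).indicator (1 : ℕ → ℝ) n +
        ∑ i ∈ Q, ({n | HitsInteger (α i) n}.indicator (1 : ℕ → ℝ) n +
          {n | HitsInteger (α i) n}.indicator (1 : ℕ → ℝ) (n + 1)) := by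
    intro n hn
    rw [Finset.mem_range] at hn
    have hnn : ∀ (A : Set ℕ) (x : ℕ), 0 ≤ A.indicator (1 : ℕ → ℝ) x := fun A x =>
      Set.indicator_nonneg (fun _ _ => zero_le_one) _
    have hsn : ∀ i ∈ Q, 0 ≤ {n | HitsInteger (α i) n}.indicator (1 : ℕ → ℝ) n +
          {n | HitsInteger (α i) n}.indicator (1 : ℕ → ℝ) (n + 1) := fun i _ =>
      add_nonneg (hnn _ _) (hnn _ _)
    by_cases ht : n ∈ tailSet α S
    · rw [Set.indicator_of_mem ht]
      rcases ht with h | ⟨i, hi, h⟩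
      · rw [Set.indicator_of_mem (show n ∈ ({0} : Set ℕ) from h)]
        exact le_add_of_nonneg_right (Finset.sum_nonneg hsn)
      · refine le_add_of_nonneg_of_le (hnn _ _) ?_
        refine le_trans ?_ (Finset.single_le_sum hsn (hQmem n hn i hi h))
        rcases h with h | h
        · rw [Set.indicator_of_mem (show n ∈ {n | HitsInteger (α i) n} from h)]
          exact le_add_of_nonneg_right (hnn _ _)
        · rw [Set.indicator_of_mem (a := n + 1) (show n + 1 ∈ {n | HitsInteger (α i) n} from h)]
          exact le_add_of_nonneg_left (hnn _ _)
    · rw [Set.indicator_of_notMem ht]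
      exact add_nonneg (hnn _ _) (Finset.sum_nonneg hsn)
  refine (Finset.sum_le_sum hpt).trans ?_
  rw [Finset.sum_add_distrib, Finset.sum_comm]
  refine add_le_add ?_ ?_
  · rw [← natCast_ncard_inter_eq_sum]
    exact_mod_cast (Set.ncard_le_ncard Set.inter_subset_right).trans (Set.ncard_singleton 0).le
  -- The constant `2 * N + 1` is `N` for hits at `n` plus `N + 1` for hits at `n + 1`.
  · have h1 : ∀ i ∈ Q, ∑ n ∈ Finset.range N,
        ({n | HitsInteger (α i) n}.indicator (1 : ℕ → ℝ) n +
          {n | HitsInteger (α i) n}.indicator (1 : ℕ → ℝ) (n + 1)) ≤ (2 * N + 1) * α i := by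
      intro i _
      rw [Finset.sum_add_distrib]
      linarith [sum_indicator_hitsInteger_le (h0 i) N, sum_indicator_hitsInteger_succ_le (h0 i) N]
    refine (Finset.sum_le_sum h1).trans ?_
    rw [← Finset.mul_sum]
    refine mul_le_mul_of_nonneg_left ?_ (by positivity)
    rw [le_sub_iff_add_le, ← Finset.sum_union Finset.sdiff_disjoint]
    exact hs.sum_le_tsum _ fun i _ => (h0 i).le

/-- Limits may be interchanged when the error of approximation is small for most parameters. -/
theorem exists_tendsto_of_approximation {β : Type*} {f : Filter β} [f.NeBot] {a : ℕ → ℝ}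
    {b e : β → ℕ → ℝ} {d ε : β → ℝ} (hb : ∀ S, Tendsto (b S) atTop (𝓝 (d S)))
    (he : ∀ S, Tendsto (e S) atTop (𝓝 (ε S))) (hε : Tendsto ε f (𝓝 0))
    (hab : ∀ S N, |a N - b S N| ≤ e S N) :
    ∃ D, Tendsto a atTop (𝓝 D) ∧ Tendsto d f (𝓝 D) := by
  have hc : CauchySeq a := by
    rw [Metric.cauchySeq_iff']
    intro η hη
    obtain ⟨S, hS⟩ := (hε.eventually_lt_const (show 0 < η / 4 by positivity)).exists
    obtain ⟨N₀, hN₀⟩ := eventually_atTop.mp (((he S).eventually_lt_const hS).and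
      (Metric.tendsto_nhds.mp (hb S) (η / 4) (by positivity)))
    have key : ∀ N ≥ N₀, dist (a N) (d S) < η / 2 := by
      intro N hN
      have h1 := hN₀ N hN
      calc dist (a N) (d S) ≤ dist (a N) (b S N) + dist (b S N) (d S) := dist_triangle _ _ _
        _ < η / 4 + η / 4 := add_lt_add (((Real.dist_eq _ _).trans_le (hab S N)).trans_lt h1.1) h1.2
        _ = η / 2 := by ring
    refine ⟨N₀, fun N hN => ?_⟩
    calc dist (a N) (a N₀) ≤ dist (a N) (d S) + dist (a N₀) (d S) := dist_triangle_right _ _ _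
      _ < η / 2 + η / 2 := add_lt_add (key N hN) (key N₀ le_rfl)
      _ = η := by ring
  obtain ⟨D, hD⟩ := cauchySeq_tendsto_of_complete hc
  refine ⟨D, hD, ?_⟩
  rw [tendsto_iff_norm_sub_tendsto_zero]
  refine squeeze_zero (fun S => norm_nonneg _) (fun S => ?_) hε
  rw [norm_sub_rev]
  exact le_of_tendsto_of_tendsto' (hD.sub (hb S)).norm (he S) (hab S)

/-- Off `tailSet α S` the true and the truncated sets agree, and the tail set has upper density at
most twice the tail of `∑ α i`, which vanishes as `S` grows. -/
theorem IsIndependentSystem.exists_natDensity {ι : Type*} {α : ι → ℝ} (h : IsIndependentSystem α)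
    {A : Set ℕ} {T : Finset ι → Set ℕ} {d : Finset ι → ℝ}
    (hT : ∀ S, HasNatDensity (T S) (d S)) (hAT : ∀ S, ∀ n ∉ tailSet α S, n ∈ A ↔ n ∈ T S) :
    ∃ D, HasNatDensity A D ∧ Tendsto d atTop (𝓝 D) := by
  refine exists_tendsto_of_approximation hT
    (e := fun S N => (1 + (2 * N + 1) * (∑' i, α i - ∑ i ∈ S, α i)) / N)
    (ε := fun S => 2 * (∑' i, α i - ∑ i ∈ S, α i)) (fun S => ?_) ?_ fun S N => ?_
  · set t := ∑' i, α i - ∑ i ∈ S, α i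
    have h1 : Tendsto (fun N : ℕ => (1 + t) * (N : ℝ)⁻¹ + 2 * t) atTop (𝓝 (2 * t)) := by
      simpa using ((tendsto_inv_atTop_nhds_zero_nat (𝕜 := ℝ)).const_mul (1 + t)).add_const (2 * t)
    refine h1.congr' ?_
    filter_upwards [eventually_gt_atTop 0] with N hN
    have : (N : ℝ) ≠ 0 := by exact_mod_cast hN.ne'
    field_simp
    ring
  · have h1 := (h.summable.hasSum.const_sub (∑' i, α i)).const_mul 2
    rw [sub_self, mul_zero] at h1
    exact h1
  · rw [← sub_div, abs_div, Nat.abs_cast]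
    exact div_le_div_of_nonneg_right ((abs_ncard_inter_sub_le (hAT S) N).trans
      (sum_indicator_tailSet_le h.pos h.summable S N)) (Nat.cast_nonneg N)

theorem IsIndependentSystem.exists_natDensity_hitSet {ι : Type*} {α : ι → ℝ}
    (h : IsIndependentSystem α) (j : ℕ) :
    ∃ D, HasNatDensity (hitSet α j) D ∧
      Tendsto (fun S => (hitPolynomial α S).coeff j) atTop (𝓝 D) := by
  refine h.exists_natDensity (fun S => h.hasNatDensity_stateCount S j) fun S n hn => ?_
  have hn0 : 0 < n := Nat.pos_of_ne_zero fun h => hn (Or.inl h)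
  simp only [hitSet, Set.mem_ofPred_eq, hn0, true_and, ncard_hits_eq_stateCount hn]

theorem IsIndependentSystem.exists_natDensity_doubleHitSet {ι : Type*} {α : ι → ℝ}
    (h : IsIndependentSystem α) (l m : ℕ) :
    ∃ D, HasNatDensity (doubleHitSet α l m) D ∧
      Tendsto (fun S => ((doubleHitPolynomial α S).coeff m).coeff l) atTop (𝓝 D) := by
  refine h.exists_natDensity (fun S => h.hasNatDensity_stateCount_two S l m) fun S n hn => ?_
  have hn0 : 0 < n := Nat.pos_of_ne_zero fun h => hn (Or.inl h)
  simp only [doubleHitSet, Set.mem_ofPred_eq, hn0, true_and, ncard_hits_eq_stateCount hn,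
    ncard_hits_succ_eq_stateCount h.lt_half hn]

/-! ### The series identity and the conclusion -/

/-- The factorial in the coefficient bound cancels that of the trinomial coefficient, leaving an
exponential series in `n` as majorant. -/
theorem multinomial_three_mul_div (l m n : ℕ) (A : ℝ) :
    (Nat.multinomial Finset.univ ![l, m, n] : ℝ) * (A ^ (l + m + n) / (l + m + n).factorial) =
      A ^ (l + m) / (l.factorial * m.factorial) * (A ^ n / n.factorial) := by
  have h : (Nat.multinomial Finset.univ ![l, m, n] : ℝ) *
      (l.factorial * m.factorial * n.factorial) = (l + m + n).factorial := by
    have := Nat.multinomial_spec Finset.univ ![l, m, n]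
    simp only [Fin.prod_univ_three, Fin.sum_univ_three, Matrix.cons_val_zero, Matrix.cons_val_one,
      Matrix.cons_val] at this
    rw [mul_comm]
    exact_mod_cast this
  rw [← h, pow_add A (l + m)]
  have h0 : (Nat.multinomial Finset.univ ![l, m, n] : ℝ) ≠ 0 := by
    intro h0
    rw [h0, zero_mul] at h
    exact (Nat.cast_ne_zero.mpr (Nat.factorial_ne_zero _)) h.symm
  field_simp

theorem IsIndependentSystem.hasSum_density {ι : Type*} {α : ι → ℝ} (h : IsIndependentSystem α)
    {d : ℕ → ℝ} (hd : ∀ j, Tendsto (fun S => (hitPolynomial α S).coeff j) atTop (𝓝 (d j)))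
    {l m : ℕ} {D : ℝ}
    (hD : Tendsto (fun S => ((doubleHitPolynomial α S).coeff m).coeff l) atTop (𝓝 D)) :
    HasSum (fun n : ℕ => (-1 : ℝ) ^ n * (Nat.multinomial Finset.univ ![l, m, n] : ℝ) *
      d (l + m + n)) D := by
  set A := ∑' i, α i
  have hA : ∀ S : Finset ι, ∑ i ∈ S, α i ≤ A := fun S =>
    h.summable.sum_le_tsum S fun i _ => (h.pos i).le
  have hA0 : ∀ S : Finset ι, 0 ≤ ∑ i ∈ S, α i := fun S => Finset.sum_nonneg fun i _ => (h.pos i).le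
  set bound : ℕ → ℝ := fun n => A ^ (l + m) / (l.factorial * m.factorial) * (A ^ n / n.factorial)
  have hbound : Summable bound := (Real.summable_pow_div_factorial A).mul_left _
  have hle : ∀ (S : Finset ι) (n : ℕ), ‖(-1 : ℝ) ^ n *
      (Nat.multinomial Finset.univ ![l, m, n] : ℝ) * (hitPolynomial α S).coeff (l + m + n)‖ ≤
        bound n := by
    intro S n
    obtain ⟨h1, h2⟩ := coeff_hitPolynomial_bounds (fun i => (h.pos i).le)
      (fun i => by linarith [h.lt_half i]) S (l + m + n)
    rw [norm_mul, norm_mul, norm_pow, norm_neg, norm_one, one_pow, one_mul, Real.norm_natCast,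
      Real.norm_of_nonneg h1]
    refine le_trans ?_ (multinomial_three_mul_div l m n A).le
    refine mul_le_mul_of_nonneg_left (h2.trans ?_) (Nat.cast_nonneg _)
    gcongr
    · exact hA0 S
    · exact hA S
  have hlim : ∀ n, Tendsto (fun S => (-1 : ℝ) ^ n *
      (Nat.multinomial Finset.univ ![l, m, n] : ℝ) * (hitPolynomial α S).coeff (l + m + n)) atTop
        (𝓝 ((-1 : ℝ) ^ n * (Nat.multinomial Finset.univ ![l, m, n] : ℝ) * d (l + m + n))) :=
    fun n => (hd _).const_mul _
  have hsum : Summable fun n : ℕ => (-1 : ℝ) ^ n *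
      (Nat.multinomial Finset.univ ![l, m, n] : ℝ) * d (l + m + n) :=
    Summable.of_norm_bounded hbound fun n =>
      le_of_tendsto' (hlim n).norm fun S => hle S n
  have ht := tendsto_tsum_of_dominated_convergence hbound hlim (Eventually.of_forall hle)
  have hD' : D = ∑' n : ℕ, (-1 : ℝ) ^ n *
      (Nat.multinomial Finset.univ ![l, m, n] : ℝ) * d (l + m + n) :=
    tendsto_nhds_unique hD
      (ht.congr fun S => (hasSum_coeff_hitPolynomial α S l m).tsum_eq)
  exact hD' ▸ hsum.hasSum

/-- The integers up to `x` form the segment of length `⌊x⌋₊ + 1`, and `(⌊x⌋₊ + 1) / x` tends to `1`.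
-/
theorem HasNatDensity.hasAsymptoticDensity {A : Set ℕ} {d : ℝ} (h : HasNatDensity A d) :
    HasAsymptoticDensity A d := by
  have h1 : Tendsto (fun x : ℝ => ⌊x⌋₊ + 1) atTop atTop :=
    tendsto_atTop_mono (fun x => Nat.le_succ _) tendsto_nat_floor_atTop
  have h2 : Tendsto (fun x : ℝ => (((⌊x⌋₊ + 1 : ℕ) : ℝ)) / x) atTop (𝓝 1) := by
    have h3 := (tendsto_nat_floor_div_atTop (R := ℝ)).add tendsto_inv_atTop_zero
    rw [add_zero] at h3
    refine h3.congr fun x => ?_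
    push_cast
    rw [add_div, one_div]
  have h3 := (h.comp h1).mul h2
  rw [mul_one] at h3
  refine h3.congr' ?_
  filter_upwards [eventually_ge_atTop 0] with x hx
  have h4 : {n : ℕ | n ∈ A ∧ (n : ℝ) ≤ x} = (Finset.range (⌊x⌋₊ + 1) : Set ℕ) ∩ A := by
    ext n
    simp only [Set.mem_ofPred_eq, Finset.coe_range, Set.mem_inter_iff, Set.mem_Iio,
      Nat.lt_add_one_iff, Nat.le_floor_iff hx]
    exact and_comm
  rw [countUpTo, h4, Function.comp_apply,
    div_mul_div_cancel₀ (Nat.cast_ne_zero.mpr (Nat.succ_ne_zero _))]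

theorem HasAsymptoticDensity.asymptoticDensity_eq {A : Set ℕ} {d : ℝ}
    (h : HasAsymptoticDensity A d) : asymptoticDensity A = d :=
  Tendsto.limUnder_eq h

theorem isIndependentSystem_invRoot {k : ℕ} (hk : 0 < k) :
    IsIndependentSystem fun B : KReduced k => invRoot k B where
  pos B := invRoot_pos B.2.1.1
  lt_half B := B.2.1.invRoot_lt hk B.2.2
  summable := summable_invRoot hk
  indep S := sum_mul_invRoot_ne_int hk S

theorem mainTheorem5 (k : ℕ) (hk : 2 ≤ k) (l m : ℕ) :
    (∀ j : ℕ, HasAsymptoticDensity (oneIntervalSet k j)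
        (asymptoticDensity (oneIntervalSet k j))) ∧
    HasAsymptoticDensity (twoIntervalSet k l m)
        (asymptoticDensity (twoIntervalSet k l m)) ∧
    HasSum
      (fun n : ℕ => (-1 : ℝ) ^ n * (Nat.multinomial Finset.univ ![l, m, n] : ℝ) *
        asymptoticDensity (oneIntervalSet k (l + m + n)))
      (asymptoticDensity (twoIntervalSet k l m)) := by
  have hk0 : 0 < k := by omega
  have hsys := isIndependentSystem_invRoot hk0
  have hone : ∀ j, oneIntervalSet k j = hitSet (fun B : KReduced k => invRoot k B) j := by
    intro j
    simp only [oneIntervalSet, hitSet, ncard_Ioo_inter_nonPowerKFull hk0]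
  have htwo : twoIntervalSet k l m = doubleHitSet (fun B : KReduced k => invRoot k B) l m := by
    simp only [twoIntervalSet, doubleHitSet, ncard_Ioo_inter_nonPowerKFull hk0,
      ← ncard_Ioo_inter_nonPowerKFull hk0 (_ + 1), add_assoc, one_add_one_eq_two]
  choose d hd hdlim using hsys.exists_natDensity_hitSet
  obtain ⟨D, hD, hDlim⟩ := hsys.exists_natDensity_doubleHitSet l m
  have hd' : ∀ j, HasAsymptoticDensity (oneIntervalSet k j) (d j) := fun j =>
    hone j ▸ (hd j).hasAsymptoticDensity
  have hD' : HasAsymptoticDensity (twoIntervalSet k l m) D := htwo ▸ hD.hasAsymptoticDensity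
  have hdeq : ∀ j, asymptoticDensity (oneIntervalSet k j) = d j := fun j =>
    (hd' j).asymptoticDensity_eq
  simp only [hdeq, hD'.asymptoticDensity_eq]
  exact ⟨hd', hD', hsys.hasSum_density hdlim hDlim⟩
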